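/- Let $(\Omega,\mathcal F,\mathbb P)$ be a standard Borel probability space and $\mathcal G\subset\mathcal F$ a sub-$\sigma$-algebra; random variables are identified if they agree almost surely. Let $L^0(\mathcal G,\mathbb R)$ and $L^0(\mathbb N)$ be the sets of $\mathcal G$-measurable random variables with values in $\mathbb R$ and in $\mathbb N=\{0,1,\dots\}$, and let \[ L^2(\mathcal F|\mathcal G)=\{x\in L^0(\mathcal F,\mathbb R):\ \mathbb E[x^2|\mathcal G]<\infty\ \text{a.s.}\}, \] an $L^0(\mathcal G,\mathbb R)$-module, with $\langle x,y\rangle=\mathbb E[xy|\mathcal G]$ and $\|x\|=\langle x,x\rangle^{1/2}$ (extended conditional expectations). A conditional sequence is a family $(x_n)_{n\in L^0(\mathbb N)}$ that commutes with countable concatenations: if $(A_k)$ is a countable $\mathcal G$-measurable partition of $\Omega$ and $n=n_k$ a.s. on $A_k$ for all $k$, then $x_n=x_{n_k}$ a.s. on $A_k$ for all $k$. For conditional sequences $(r_n)$ in $L^0(\mathcal G,\mathbb R)$ and $(x_n)$ in $L^2(\mathcal F|\mathcal G)$, we write $y=\sum_n r_nx_n$ if the conditional sequence $(s_n)$ with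 $s_0=0$ and $s_{n+1}=s_n+r_nx_n$ for $n\in L^0(\mathbb N)$ converges to $y$ conditionally: for each $\varepsilon\in L^0(\mathcal G,\mathbb R)$ with $\varepsilon>0$ a.s. there is $n_0\in L^0(\mathbb N)$ such that $\|s_n-y\|<\varepsilon$ a.s. for all $n\in L^0(\mathbb N)$ with $n\ge n_0$ a.s. A conditional sequence $(x_n)$ in $L^2(\mathcal F|\mathcal G)$ is orthogonal if $\langle x_n,x_m\rangle=0$ a.s. whenever $\mathbb P(n=m)=0$, generating if every $y\in L^2(\mathcal F|\mathcal G)$ is of the form $y=\sum_n r_nx_n$ for some conditional sequence $(r_n)$ in $L^0(\mathcal G,\mathbb R)$, and an orthonormal basis if it is orthogonal and generating and $\|x_n\|=1$ a.s. for all $n\in L^0(\mathbb N)$. Call $L^2(\mathcal F|\mathcal G)$ conditionally infinite dimensional if for no $A\in\mathcal G$ with $\mathbb P(A)>0$ the module $1_A L^2(\mathcal F|\mathcal G)$ is finitely generated over $L^0(\mathcal G,\mathbb R)$. Theorem. (1) If $L^2(\mathcal F|\mathcal G)$ is conditionally infinite dimensional, then it has an orthonormal basis $(x_n)_{n\in L^0(\mathbb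 N)}$. (2) In general, there are a $\mathcal G$-measurable $d:\Omega\to\mathbb N\cup\{\infty\}$ with $d\ge 1$ a.s. and an orthogonal and generating conditional sequence $(x_n)_{n\in L^0(\mathbb N)}$ in $L^2(\mathcal F|\mathcal G)$ such that, for all $n$, $\|x_n\|=1$ a.s. on $\{n<d\}$ and $x_n=0$ a.s. on $\{n\ge d\}$; that is, $L^2(\mathcal F|\mathcal G)$ has an orthonormal basis indexed by the conditional numbers $n<d$. (3) By contrast, if $\mathcal G$ contains infinitely many pairwise disjoint sets of positive probability and $L^2(\mathcal F|\mathcal G)$ is not finitely generated over $L^0(\mathcal G,\mathbb R)$, then it has no algebraic basis, i.e. it is not a free $L^0(\mathcal G,\mathbb R)$-module. In particular (such spaces exist), for some choice of $(\Omega,\mathcal F,\mathbb P)$ and $\mathcal G$ the module $L^2(\mathcal F|\mathcal G)$ is conditionally infinite dimensional and has no algebraic basis. -/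

import Mathlib

open MeasureTheory
open scoped ENNReal

namespace CondHilbert

section

variable {Ω : Type*}

/-- `L⁰(𝓕, ℝ)`, the random variables modulo almost sure equality, is a commutative ring under the
pointwise operations (which are Mathlib's operations on `Ω →ₘ[P] ℝ`). -/
noncomputable instance instCommRingL0 {mΩ : MeasurableSpace Ω} (P : Measure Ω) :
    CommRing (Ω →ₘ[P] ℝ) :=
  { (inferInstance : AddCommGroup (Ω →ₘ[P] ℝ)), (inferInstance : CommMonoid (Ω →ₘ[P] ℝ)) with
    left_distrib := by
      intro a b c
      apply AEEqFun.ext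
      filter_upwards [AEEqFun.coeFn_mul a (b + c), AEEqFun.coeFn_add b c,
        AEEqFun.coeFn_add (a * b) (a * c), AEEqFun.coeFn_mul a b, AEEqFun.coeFn_mul a c]
        with ω h1 h2 h3 h4 h5
      simp only [h1, h2, h3, h4, h5, Pi.mul_apply, Pi.add_apply, mul_add]
    right_distrib := by
      intro a b c
      apply AEEqFun.ext
      filter_upwards [AEEqFun.coeFn_mul (a + b) c, AEEqFun.coeFn_add a b,
        AEEqFun.coeFn_add (a * c) (b * c), AEEqFun.coeFn_mul a c, AEEqFun.coeFn_mul b c]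
        with ω h1 h2 h3 h4 h5
      simp only [h1, h2, h3, h4, h5, Pi.mul_apply, Pi.add_apply, add_mul]
    zero_mul := by
      intro a
      apply AEEqFun.ext
      filter_upwards [AEEqFun.coeFn_mul 0 a, AEEqFun.coeFn_zero (μ := P) (α := Ω) (β := ℝ)]
        with ω h1 h2
      simp only [h1, h2, Pi.mul_apply, Pi.zero_apply, zero_mul]
    mul_zero := by
      intro a
      apply AEEqFun.ext
      filter_upwards [AEEqFun.coeFn_mul a 0, AEEqFun.coeFn_zero (μ := P) (α := Ω) (β := ℝ)]
        with ω h1 h2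
      simp only [h1, h2, Pi.mul_apply, Pi.zero_apply, mul_zero] }

/-- `L⁰(𝓖, ℝ)`: the subring of `L⁰(𝓕, ℝ)` of the classes with a `𝓖`-measurable representative. -/
noncomputable def L0R (G : MeasurableSpace Ω) {mΩ : MeasurableSpace Ω} (P : Measure Ω) :
    Subring (Ω →ₘ[P] ℝ) where
  carrier := {f | AEStronglyMeasurable[G] f P}
  mul_mem' {a b} ha hb := (AEStronglyMeasurable.mul ha hb).congr (AEEqFun.coeFn_mul a b).symm
  one_mem' := (aestronglyMeasurable_const (b := (1 : ℝ))).congr AEEqFun.coeFn_one.symm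
  add_mem' {a b} ha hb := (AEStronglyMeasurable.add ha hb).congr (AEEqFun.coeFn_add a b).symm
  zero_mem' := (aestronglyMeasurable_const (b := (0 : ℝ))).congr AEEqFun.coeFn_zero.symm
  neg_mem' {a} ha := (AEStronglyMeasurable.neg ha).congr (AEEqFun.coeFn_neg a).symm

/-- `L⁰(ℕ)` over the base space `(Ω, 𝓖, P)`: the conditional natural numbers. -/
noncomputable def L0N (G : MeasurableSpace Ω) {mΩ : MeasurableSpace Ω} (P : Measure Ω) :
    AddSubmonoid (Ω →ₘ[P] ℕ) where
  carrier := {f | AEStronglyMeasurable[G] f P}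
  add_mem' {a b} ha hb := (AEStronglyMeasurable.add ha hb).congr (AEEqFun.coeFn_add a b).symm
  zero_mem' := (aestronglyMeasurable_const (b := (0 : ℕ))).congr AEEqFun.coeFn_zero.symm

/-- The constant `1` in `L⁰(ℕ)`. -/
noncomputable instance instOneL0N (G : MeasurableSpace Ω) {mΩ : MeasurableSpace Ω} (P : Measure Ω) :
    One (L0N G P) :=
  ⟨⟨1, (aestronglyMeasurable_const (b := (1 : ℕ))).congr AEEqFun.coeFn_one.symm⟩⟩

/-- The (extended) conditional expectation commutes with `𝓖`-measurable factors; only finiteness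
is needed here. -/
theorem condLExp_mul_lt_top {G mΩ : MeasurableSpace Ω} {P : Measure Ω}
    {c : Ω → ℝ≥0∞} {X : Ω → ℝ≥0∞}
    (hc : Measurable[G] c) (hc' : ∀ ω, c ω < ∞) (hX : AEMeasurable X P)
    (h : ∀ᵐ ω ∂P, condLExp G P X ω < ∞) :
    ∀ᵐ ω ∂P, condLExp G P (fun ω => c ω * X ω) ω < ∞ := by
  by_cases hm : G ≤ mΩ
  swap
  · simp [condLExp_of_not_le hm]
  by_cases hσ : SigmaFinite (P.trim hm)
  swap
  · simp [condLExp_of_not_sigmaFinite hm hσ]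
  have hcm : Measurable c := hc.mono hm le_rfl
  have key : (P.withDensity (condLExp G P X)).trim hm = (P.withDensity X).trim hm := by
    refine @Measure.ext _ G _ _ fun s hs => ?_
    rw [trim_measurableSet_eq hm hs, trim_measurableSet_eq hm hs, withDensity_apply _ (hm s hs),
      withDensity_apply _ (hm s hs), setLIntegral_condLExp hm P X hs]
  have hE : (fun ω => c ω * condLExp G P X ω) =ᵐ[P] condLExp G P (fun ω => c ω * X ω) := by
    refine ae_eq_condLExp hm P _ (hc.mul (measurable_condLExp G P X)) fun s hs => ?_
    have hcs : Measurable[G] (s.indicator c) := hc.indicator hs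
    have e1 : ∀ Y : Ω → ℝ≥0∞, AEMeasurable Y P →
        ∫⁻ ω in s, c ω * Y ω ∂P = ∫⁻ ω, s.indicator c ω ∂((P.withDensity Y).trim hm) := by
      intro Y hY
      rw [lintegral_trim hm hcs, lintegral_withDensity_eq_lintegral_mul₀ hY
        (hcs.mono hm le_rfl).aemeasurable, ← lintegral_indicator (hm s hs)]
      refine lintegral_congr fun ω => ?_
      by_cases hω : ω ∈ s <;> simp [hω, mul_comm]
    rw [e1 _ (measurable_condLExp' G P X).aemeasurable, e1 _ hX, key]
  filter_upwards [h, hE] with ω h1 h2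
  rw [← h2]
  exact ENNReal.mul_lt_top (hc' ω) h1

/-- The conditional space `L²(𝓕|𝓖) = {x ∈ L⁰(𝓕, ℝ) : 𝔼[x²|𝓖] < ∞ a.s.}` as an `L⁰(𝓖, ℝ)`-module.
The extended conditional expectation of a nonnegative function is Mathlib's `condLExp`. -/
noncomputable def L2 (G : MeasurableSpace Ω) {mΩ : MeasurableSpace Ω} (P : Measure Ω) :
    Submodule (L0R G P) (Ω →ₘ[P] ℝ) where
  carrier := {x | ∀ᵐ ω ∂P, condLExp G P (fun ω => ENNReal.ofReal (x ω ^ 2)) ω < ∞}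
  zero_mem' := by
    have h : condLExp G P (fun ω => ENNReal.ofReal ((0 : Ω →ₘ[P] ℝ) ω ^ 2)) =ᵐ[P]
        condLExp G P 0 := by
      refine condLExp_congr_ae ?_
      filter_upwards [AEEqFun.coeFn_zero (μ := P) (α := Ω) (β := ℝ)] with ω h
      simp [h]
    filter_upwards [h] with ω h
    simp [h]
  add_mem' := by
    intro x y hx hy
    have hxm : AEMeasurable (fun ω => ENNReal.ofReal (x ω ^ 2)) P := by
      have := x.aemeasurable
      fun_prop
    have h2 := condLExp_mono (mΩ := G) (P := P)
      (X := fun ω => ENNReal.ofReal ((x + y : Ω →ₘ[P] ℝ) ω ^ 2))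
      (Y := (2 : ℝ≥0∞) • ((fun ω => ENNReal.ofReal (x ω ^ 2)) +
        fun ω => ENNReal.ofReal (y ω ^ 2))) (by
          filter_upwards [AEEqFun.coeFn_add x y] with ω h
          simp only [h, Pi.add_apply, Pi.smul_apply, smul_eq_mul]
          rw [← ENNReal.ofReal_add (sq_nonneg _) (sq_nonneg _),
            show (2 : ℝ≥0∞) = ENNReal.ofReal 2 by simp, ← ENNReal.ofReal_mul (by norm_num)]
          exact ENNReal.ofReal_le_ofReal (by nlinarith [sq_nonneg (x ω - y ω)]))
    have h3 := condLExp_smul' (mΩ := G) (P := P) (c := 2)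
      ((fun ω => ENNReal.ofReal (x ω ^ 2)) + fun ω => ENNReal.ofReal (y ω ^ 2)) (by simp)
    have h4 := condLExp_add_left (mΩ := G) (P := P) (fun ω => ENNReal.ofReal (y ω ^ 2)) hxm
    filter_upwards [hx, hy, h2, h3, h4] with ω h0 h1 h2 h3 h4
    refine h2.trans_lt ?_
    rw [h3, Pi.smul_apply, h4, smul_eq_mul]
    exact ENNReal.mul_lt_top (by simp) (ENNReal.add_lt_top.2 ⟨h0, h1⟩)
  smul_mem' := by
    rintro ⟨r, hr⟩ x hx
    obtain ⟨r', hr', hrr'⟩ := hr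
    have hxm : AEMeasurable (fun ω => ENNReal.ofReal (x ω ^ 2)) P := by
      have := x.aemeasurable
      fun_prop
    have h1 := condLExp_mul_lt_top (G := G) (P := P) (c := fun ω => ENNReal.ofReal (r' ω ^ 2))
      (ENNReal.measurable_ofReal.comp (hr'.measurable.pow_const 2)) (fun ω => by simp) hxm hx
    have h2 : condLExp G P (fun ω => ENNReal.ofReal ((r * x : Ω →ₘ[P] ℝ) ω ^ 2)) =ᵐ[P]
        condLExp G P (fun ω => ENNReal.ofReal (r' ω ^ 2) * ENNReal.ofReal (x ω ^ 2)) := by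
      refine condLExp_congr_ae ?_
      filter_upwards [AEEqFun.coeFn_mul r x, hrr'] with ω h3 h4
      rw [h3, Pi.mul_apply, h4, mul_pow, ENNReal.ofReal_mul (sq_nonneg _)]
    filter_upwards [h1, h2] with ω h1 h2
    exact h2.trans_lt h1

/-- The extended conditional expectation `𝔼[z|𝓖] = 𝔼[z⁺|𝓖] - 𝔼[z⁻|𝓖]`, meaningful as soon as
`𝔼[|z| |𝓖] < ∞` almost surely, even if `z` is not integrable. -/
noncomputable def condE (G : MeasurableSpace Ω) {mΩ : MeasurableSpace Ω} (P : Measure Ω)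
    (z : Ω → ℝ) : Ω → ℝ := fun ω =>
  (condLExp G P (fun ω => ENNReal.ofReal (z ω)) ω).toReal -
    (condLExp G P (fun ω => ENNReal.ofReal (-z ω)) ω).toReal

variable {G mΩ : MeasurableSpace Ω} {P : Measure Ω}

/-- The inner product `⟨x, y⟩ = 𝔼[xy|𝓖]` (a version of it). -/
noncomputable def cinner (x y : L2 G P) : Ω → ℝ :=
  condE G P fun ω => (x : Ω →ₘ[P] ℝ) ω * (y : Ω →ₘ[P] ℝ) ω

/-- The conditional norm `‖x‖ = 𝔼[x²|𝓖]^{1/2}`. -/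
noncomputable def cnorm (x : L2 G P) : Ω → ℝ := fun ω => √(cinner x x ω)

/-- A countable `𝓖`-measurable partition of `Ω` (some of the sets may be empty). -/
def IsPartition (G : MeasurableSpace Ω) (A : ℕ → Set Ω) : Prop :=
  (∀ k, MeasurableSet[G] (A k)) ∧ Pairwise (Function.onFun Disjoint A) ∧ ⋃ k, A k = Set.univ

/-- `x = ∑ₖ xₖ|Aₖ`: `x` agrees with `xₖ` almost surely on `Aₖ` for each `k`. -/
def IsConcat {E : Type*} [TopologicalSpace E] (A : ℕ → Set Ω) (xs : ℕ → Ω →ₘ[P] E)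
    (x : Ω →ₘ[P] E) : Prop :=
  ∀ k, ∀ᵐ ω ∂P, ω ∈ A k → x ω = xs k ω

/-- A family indexed by `L⁰(ℕ)` is a conditional sequence if it commutes with countable
concatenations. -/
def IsCondSeq {E : Type*} [TopologicalSpace E] (f : L0N G P → Ω →ₘ[P] E) : Prop :=
  ∀ A : ℕ → Set Ω, IsPartition G A → ∀ (ns : ℕ → L0N G P) (n : L0N G P),
    IsConcat A (fun k => (ns k : Ω →ₘ[P] ℕ)) (n : Ω →ₘ[P] ℕ) →
      IsConcat A (fun k => f (ns k)) (f n)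

/-- Conditional convergence of `(sₙ)`, `n ∈ L⁰(ℕ)`, to `y`: for every `ε > 0` in `L⁰(𝓖, ℝ)` there is
`n₀ ∈ L⁰(ℕ)` with `‖sₙ - y‖ < ε` for all `n ≥ n₀` in `L⁰(ℕ)`. -/
def CondTendsto (s : L0N G P → L2 G P) (y : L2 G P) : Prop :=
  ∀ ε : L0R G P, (∀ᵐ ω ∂P, 0 < (ε : Ω →ₘ[P] ℝ) ω) →
    ∃ n₀ : L0N G P, ∀ n : L0N G P, (n₀ : Ω →ₘ[P] ℕ) ≤ (n : Ω →ₘ[P] ℕ) →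
      ∀ᵐ ω ∂P, cnorm (s n - y) ω < (ε : Ω →ₘ[P] ℝ) ω

/-- `y = ∑ₙ rₙ xₙ` in the conditional model: `y` is the conditional limit of the conditional
sequence of partial sums `sₙ = ∑_{m < n} r_m x_m`, which is given by `s₀ = 0` and
`sₙ₊₁ = sₙ + rₙ xₙ` for `n ∈ L⁰(ℕ)`. -/
def IsCondSum (r : L0N G P → L0R G P) (x : L0N G P → L2 G P) (y : L2 G P) : Prop :=
  ∃ s : L0N G P → L2 G P, IsCondSeq (fun n => (s n : Ω →ₘ[P] ℝ)) ∧ s 0 = 0 ∧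
    (∀ n, s (n + 1) = s n + r n • x n) ∧ CondTendsto s y

/-- `⟨xₙ, xₘ⟩ = 0` whenever `P(n = m) = 0`. -/
def IsOrthogonal (x : L0N G P → L2 G P) : Prop :=
  ∀ n m : L0N G P, P {ω | (n : Ω →ₘ[P] ℕ) ω = (m : Ω →ₘ[P] ℕ) ω} = 0 →
    ∀ᵐ ω ∂P, cinner (x n) (x m) ω = 0

/-- Every `y ∈ L²(𝓕|𝓖)` is a sum `∑ₙ rₙ xₙ` with a conditional sequence `(rₙ)` in `L⁰(𝓖, ℝ)`. -/
def IsGenerating (x : L0N G P → L2 G P) : Prop :=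
  ∀ y : L2 G P, ∃ r : L0N G P → L0R G P,
    IsCondSeq (fun n => (r n : Ω →ₘ[P] ℝ)) ∧ IsCondSum r x y

/-- An orthonormal basis: a generating orthonormal conditional sequence `(xₙ)`, `n ∈ L⁰(ℕ)`. -/
structure IsONB (x : L0N G P → L2 G P) : Prop where
  condSeq : IsCondSeq (fun n => (x n : Ω →ₘ[P] ℝ))
  orthogonal : IsOrthogonal x
  normalized : ∀ n, ∀ᵐ ω ∂P, cnorm (x n) ω = 1
  generating : IsGenerating x

/-- An orthonormal basis of conditional length `d`: the vectors are indexed by the conditional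
numbers `n < d`; the family is extended by zero, that is, `xₙ` is normalized on `{n < d}` and
vanishes on `{n ≥ d}`. -/
structure IsONBOfDim (d : Ω → ℕ∞) (x : L0N G P → L2 G P) : Prop where
  condSeq : IsCondSeq (fun n => (x n : Ω →ₘ[P] ℝ))
  orthogonal : IsOrthogonal x
  normalized : ∀ n : L0N G P, ∀ᵐ ω ∂P, ((n : Ω →ₘ[P] ℕ) ω : ℕ∞) < d ω → cnorm (x n) ω = 1
  vanishing : ∀ n : L0N G P, ∀ᵐ ω ∂P,
    d ω ≤ ((n : Ω →ₘ[P] ℕ) ω : ℕ∞) → (x n : Ω →ₘ[P] ℝ) ω = 0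
  generating : IsGenerating x

/-- `1_A L²(𝓕|𝓖)` is finitely generated over `L⁰(𝓖, ℝ)`. -/
def FinGenOn (G : MeasurableSpace Ω) {mΩ : MeasurableSpace Ω} (P : Measure Ω) (A : Set Ω) : Prop :=
  ∃ (k : ℕ) (g : Fin k → L2 G P), ∀ y : L2 G P, ∃ r : Fin k → L0R G P,
    ∀ᵐ ω ∂P, ω ∈ A →
      (y : Ω →ₘ[P] ℝ) ω = ∑ i, (r i : Ω →ₘ[P] ℝ) ω * (g i : Ω →ₘ[P] ℝ) ω

/-- `L²(𝓕|𝓖)` is conditionally infinite dimensional: it is not finitely generated on any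
`A ∈ 𝓖` of positive probability. -/
def CondInfiniteDim (G : MeasurableSpace Ω) {mΩ : MeasurableSpace Ω} (P : Measure Ω) : Prop :=
  ∀ A : Set Ω, MeasurableSet[G] A → P A ≠ 0 → ¬ FinGenOn G P A

end

end CondHilbert

/-! On a standard Borel space the conditional expectation is integration against conditional laws
κ_ω (`condExpKernel`), so L²(𝓕|𝓖) behaves like a measurable field of the Hilbert spaces L²(κ_ω). By
`mem_L2_iff` and `cinner_ae_eq`, membership and inner product are computed fibre by fibre; by
`ae_condExpKernel_eq_const`, 𝓖-measurable scalars and indices are constants on almost every fibre.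

A countable π-system generating 𝓕 gives indicators whose span is dense in every L²(κ_ω).
Gram-Schmidt with 𝓖-measurable coefficients orthogonalizes them in almost all fibres at once;
deleting the vectors that vanish in a fibre and closing the gaps gives (x_k), and d(ω) counts the
survivors (`exists_fibrewise_basis`). For n ∈ L⁰(ℕ) the basis vector is ω ↦ x_{n(ω)}(ω), which on
the fibre of ω is the single vector x_{n(ω)}. Fourier series converge in each fibre, and a
𝓖-measurable choice of threshold turns this into conditional convergence. Where d ≤ m the series
stops after m terms, so the module is finitely generated there; hence conditional infinite dimension
forces d = ∞ a.s.

An infinite algebraic basis is impossible over an infinite base: gluing distinct basis vectors along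
disjoint non-null sets of 𝓖 gives an element with infinitely many nonzero coordinates
(`not_free_of_not_finite`). -/

namespace CondHilbert

open ProbabilityTheory Filter InnerProductSpace

/-! ### Disintegration into conditional laws -/

section Fibres

/-- The joint law of `P.trim hG` and the conditional law is the image of P under the diagonal; the
facts below that rest on this joint law need the diagonal measurable into 𝓖 ⊗ 𝓕. -/
theorem measurable_diag_prod {Ω : Type*} {G : MeasurableSpace Ω} [mΩ : MeasurableSpace Ω]
    (hG : G ≤ mΩ) :
    @Measurable Ω (Ω × Ω) mΩ (G.prod mΩ) Function.diag :=
  @Measurable.prodMk Ω mΩ Ω Ω G mΩ id id (measurable_id.mono hG le_rfl) measurable_id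

variable {Ω : Type*} {G : MeasurableSpace Ω} [mΩ : MeasurableSpace Ω] [StandardBorelSpace Ω]
  {P : Measure Ω} [IsProbabilityMeasure P]

/-- The extended conditional expectation is integration against the conditional law. -/
theorem condLExp_ae_eq_lintegral_condExpKernel (hG : G ≤ mΩ) {f : Ω → ℝ≥0∞} (hf : Measurable f) :
    condLExp G P f =ᵐ[P] fun ω => ∫⁻ ω', f ω' ∂condExpKernel P G ω := by
  symm
  have hm : Measurable[G] fun ω => ∫⁻ ω', f ω' ∂condExpKernel P G ω :=
    hf.lintegral_kernel
  refine ae_eq_condLExp hG P _ hm fun s hs => ?_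
  -- The function 1_s(z₁) f(z₂) is integrated in two ways: iteratively against the kernel, and along
  -- the diagonal under P.
  have hF : Measurable[G.prod mΩ] fun z : Ω × Ω => s.indicator (fun _ => (1 : ℝ≥0∞)) z.1 * f z.2 :=
    ((measurable_const.indicator hs).comp measurable_fst).mul (hf.comp measurable_snd)
  have h1 := Measure.lintegral_compProd (μ := P.trim hG) (κ := condExpKernel P G) hF
  rw [compProd_trim_condExpKernel hG, @lintegral_map _ _ mΩ (G.prod mΩ) P _ _ hF
    (measurable_diag_prod hG)] at h1
  rw [← lintegral_indicator (hG s hs), ← lintegral_indicator (hG s hs)]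
  rw [lintegral_trim hG hF.lintegral_kernel_prod_right'] at h1
  convert h1.symm using 2 with ω ω
  · ext ω
    by_cases h : ω ∈ s <;> simp [h]
  · ext ω
    by_cases h : ω ∈ s <;> simp [h, Function.diag]

/-- A `𝓖`-measurable random variable is constant under almost every conditional law. -/
theorem ae_condExpKernel_eq_const (hG : G ≤ mΩ) {β : Type*} [MeasurableSpace β]
    [MeasurableEq β] {r : Ω → β} (hr : Measurable[G] r) :
    ∀ᵐ ω ∂P, ∀ᵐ ω' ∂condExpKernel P G ω, r ω' = r ω := by
  have hr' : Measurable r := hr.mono hG le_rfl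
  have hs : MeasurableSet[G.prod mΩ] {z : Ω × Ω | r z.2 = r z.1} :=
    measurableSet_eq_fun (hr'.comp measurable_snd) (hr.comp measurable_fst)
  -- The joint law lives on the diagonal, where the claimed equality is reflexivity.
  refine ae_of_ae_trim hG (Measure.ae_ae_of_ae_compProd (p := fun z => r z.2 = r z.1) ?_)
  rw [compProd_trim_condExpKernel hG]
  refine (@ae_map_iff _ _ mΩ (G.prod mΩ) P _
    (@Measurable.aemeasurable _ _ _ (G.prod mΩ) _ _ (measurable_diag_prod hG)) _ hs).2 ?_
  exact ae_of_all _ fun ω => rfl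

/-- P is the mixture of its conditional laws, so a P-null set is null for almost all of them. -/
theorem ae_ae_condExpKernel_of_ae (hG : G ≤ mΩ) {q : Ω → Prop} (h : ∀ᵐ ω ∂P, q ω) :
    ∀ᵐ ω ∂P, ∀ᵐ ω' ∂condExpKernel P G ω, q ω' := by
  refine ae_of_ae_trim hG (Measure.ae_ae_of_ae_comp ?_)
  rwa [condExpKernel_comp_trim hG]

/-- The probability of the exceptional set is the integral of its conditional probability, which
vanishes. -/
theorem ae_of_ae_ae_condExpKernel (hG : G ≤ mΩ) {q : Ω → Prop} (hq : MeasurableSet {ω | q ω})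
    (h : ∀ᵐ ω ∂P, ∀ᵐ ω' ∂condExpKernel P G ω, q ω') : ∀ᵐ ω ∂P, q ω := by
  have h1 := condLExp_ae_eq_lintegral_condExpKernel (P := P) hG
    (f := {ω | q ω}ᶜ.indicator fun _ => 1) (measurable_const.indicator hq.compl)
  have h2 := lintegral_condLExp hG P ({ω | q ω}ᶜ.indicator fun _ => 1)
  rw [lintegral_indicator_const hq.compl, one_mul] at h2
  rw [ae_iff]
  change P {ω | q ω}ᶜ = 0
  rw [← h2, lintegral_eq_zero_iff (measurable_condLExp' _ _ _)]
  filter_upwards [h, h1] with ω h h1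
  rw [h1, lintegral_indicator_const hq.compl, one_mul]
  exact h

theorem mem_L2_iff (hG : G ≤ mΩ) (x : Ω →ₘ[P] ℝ) :
    x ∈ L2 G P ↔ ∀ᵐ ω ∂P, MemLp x 2 (condExpKernel P G ω) := by
  have hx : Measurable x := x.stronglyMeasurable.measurable
  have h := condLExp_ae_eq_lintegral_condExpKernel (P := P) hG
    (f := fun ω => ENNReal.ofReal (x ω ^ 2)) (by fun_prop)
  change (∀ᵐ ω ∂P, condLExp G P (fun ω => ENNReal.ofReal (x ω ^ 2)) ω < ∞) ↔ _
  refine eventually_congr ?_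
  filter_upwards [h] with ω h
  rw [h, memLp_two_iff_integrable_sq x.stronglyMeasurable.aestronglyMeasurable, Integrable,
    hasFiniteIntegral_iff_ofReal (ae_of_all _ fun _ => sq_nonneg _)]
  exact (and_iff_right (x.stronglyMeasurable.pow 2).aestronglyMeasurable).symm

theorem mk_mem_L2 (hG : G ≤ mΩ) {f : Ω → ℝ} (hf : AEStronglyMeasurable f P)
    (h : ∀ᵐ ω ∂P, MemLp f 2 (condExpKernel P G ω)) : AEEqFun.mk f hf ∈ L2 G P := by
  rw [mem_L2_iff hG]
  filter_upwards [h, ae_ae_condExpKernel_of_ae hG (AEEqFun.coeFn_mk f hf)] with ω h h'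
  exact (memLp_congr_ae h').2 h

/-- The product of two functions in L²(κ_ω) is κ_ω-integrable, so the difference of the integrals of
its positive and negative parts is its Bochner integral. -/
theorem cinner_ae_eq (hG : G ≤ mΩ) (x y : L2 G P) :
    cinner x y =ᵐ[P] fun ω =>
      ∫ ω', (x : Ω →ₘ[P] ℝ) ω' * (y : Ω →ₘ[P] ℝ) ω' ∂condExpKernel P G ω := by
  have hx : Measurable (x : Ω →ₘ[P] ℝ) := (x : Ω →ₘ[P] ℝ).stronglyMeasurable.measurable
  have hy : Measurable (y : Ω →ₘ[P] ℝ) := (y : Ω →ₘ[P] ℝ).stronglyMeasurable.measurable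
  filter_upwards [(mem_L2_iff hG _).1 x.2, (mem_L2_iff hG _).1 y.2,
    condLExp_ae_eq_lintegral_condExpKernel (P := P) hG
      (f := fun ω => ENNReal.ofReal ((x : Ω →ₘ[P] ℝ) ω * (y : Ω →ₘ[P] ℝ) ω)) (by fun_prop),
    condLExp_ae_eq_lintegral_condExpKernel (P := P) hG
      (f := fun ω => ENNReal.ofReal (-((x : Ω →ₘ[P] ℝ) ω * (y : Ω →ₘ[P] ℝ) ω))) (by fun_prop)]
    with ω h1 h2 h3 h4
  rw [cinner, condE, h3, h4]
  exact (integral_eq_lintegral_pos_part_sub_lintegral_neg_part (h1.integrable_mul h2)).symm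

end Fibres

/-! ### Deleting zero vectors from an orthogonal sequence -/

section Reindexing

/-- `n` is smaller than the cardinality of `{k | p k}` iff some `k` is its `n`-th element. -/
theorem lt_encard_iff_exists_count (p : ℕ → Prop) [DecidablePred p] (n : ℕ) :
    (n : ℕ∞) < {k | p k}.encard ↔ ∃ k, p k ∧ Nat.count p k = n := by
  have key : (n : ℕ∞) < {k | p k}.encard ↔
      ∀ hf : (Set.ofPred p).Finite, n < hf.toFinset.card := by
    constructor
    · intro h hf
      have : {k | p k}.encard = hf.toFinset.card := hf.encard_eq_coe_toFinset_card
      rw [this] at h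
      exact_mod_cast h
    · intro h
      by_cases hf : {k | p k}.Finite
      · rw [hf.encard_eq_coe_toFinset_card]
        exact_mod_cast h hf
      · rw [Set.Infinite.encard_eq hf]
        exact ENat.natCast_lt_top n
  rw [key]
  constructor
  · intro h
    exact ⟨Nat.nth p n, Nat.nth_mem n h, Nat.count_nth h⟩
  · rintro ⟨k, hk, rfl⟩ hf
    exact Nat.count_lt_card hf hk

variable {H : Type*} [NormedAddCommGroup H] [InnerProductSpace ℝ H]

/-- Fourier expansion along an orthogonal sequence of unit or zero vectors with dense span. -/
theorem tendsto_fourier_of_orthonormal_or_zero [CompleteSpace H] {w : ℕ → H}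
    (hw : Pairwise fun i j => inner ℝ (w i) (w j) = 0)
    (hn : ∀ n, w n ≠ 0 → ‖w n‖ = 1)
    (hd : (Submodule.span ℝ (Set.range w)).topologicalClosure = ⊤) (y : H) :
    Tendsto (fun N => ∑ n ∈ Finset.range N, inner ℝ (w n) y • w n) atTop (nhds y) := by
  let S : Set ℕ := {n | w n ≠ 0}
  have ho : Orthonormal ℝ (fun n : S => w n) :=
    ⟨fun n => hn n n.2, fun i j hij => hw (Subtype.coe_injective.ne hij)⟩
  have hspan : Submodule.span ℝ (Set.range fun n : S => w n) = Submodule.span ℝ (Set.range w) := by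
    apply le_antisymm (Submodule.span_mono (by rintro _ ⟨n, rfl⟩; exact ⟨n, rfl⟩))
    rw [Submodule.span_le]
    rintro _ ⟨n, rfl⟩
    by_cases h : w n = 0
    · rw [h]; exact Submodule.zero_mem _
    · exact Submodule.subset_span ⟨⟨n, h⟩, rfl⟩
  let b := HilbertBasis.mk ho (by rw [hspan, hd])
  have h1 : HasSum (fun n : S => inner ℝ (w n) y • w n) y := by
    simpa [b, HilbertBasis.repr_apply_apply] using b.hasSum_repr y
  -- The deleted indices contribute zero terms, so the expansion may run over all of ℕ in its
  -- natural order.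
  have h2 : HasSum (fun n => inner ℝ (w n) y • w n) y := by
    refine (hasSum_subtype_iff_of_support_subset (s := S) ?_).1 h1
    intro n hn hw0
    exact hn (by simp [hw0])
  exact h2.tendsto_sum_nat

/-- Dropping the zero vectors from a sequence: the `n`-th nonzero vector, or zero if there is
none. -/
noncomputable def dropZeros {E : Type*} [Zero E] (p : ℕ → Prop) (u : ℕ → E) (n : ℕ) : E :=
  open Classical in if (n : ℕ∞) < {k | p k}.encard then u (Nat.nth p n) else 0

theorem dropZeros_eq {E : Type*} [Zero E] {p : ℕ → Prop} [DecidablePred p] (u : ℕ → E) {k : ℕ}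
    (hk : p k) : dropZeros p u (Nat.count p k) = u k := by
  rw [dropZeros, if_pos ((lt_encard_iff_exists_count p _).2 ⟨k, hk, rfl⟩), Nat.nth_count hk]

theorem dropZeros_of_le {E : Type*} [Zero E] {p : ℕ → Prop} (u : ℕ → E) {n : ℕ}
    (h : {k | p k}.encard ≤ n) : dropZeros p u n = 0 := by
  rw [dropZeros, if_neg h.not_gt]

theorem dropZeros_cases {E : Type*} [Zero E] {p : ℕ → Prop} [DecidablePred p] (u : ℕ → E) (n : ℕ) :
    (∃ k, p k ∧ Nat.count p k = n ∧ dropZeros p u n = u k) ∨ dropZeros p u n = 0 := by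
  by_cases h : (n : ℕ∞) < {k | p k}.encard
  · obtain ⟨k, hk, rfl⟩ := (lt_encard_iff_exists_count p n).1 h
    exact Or.inl ⟨k, hk, rfl, dropZeros_eq u hk⟩
  · exact Or.inr (dropZeros_of_le u (not_lt.1 h))

theorem pairwise_inner_dropZeros {p : ℕ → Prop} {u : ℕ → H}
    (hu : Pairwise fun i j => inner ℝ (u i) (u j) = 0) :
    Pairwise fun i j => inner ℝ (dropZeros p u i) (dropZeros p u j) = 0 := by
  classical
  intro i j hij
  rcases dropZeros_cases (p := p) u i with ⟨k, hk, rfl, h1⟩ | h1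
  · rcases dropZeros_cases (p := p) u j with ⟨l, hl, rfl, h2⟩ | h2
    · rw [h1, h2]
      exact hu fun h => hij (by rw [h])
    · simp [h2]
  · simp [h1]

theorem span_range_dropZeros {p : ℕ → Prop} {u : ℕ → H} (hp : ∀ k, u k ≠ 0 → p k) :
    Submodule.span ℝ (Set.range (dropZeros p u)) = Submodule.span ℝ (Set.range u) := by
  classical
  apply le_antisymm <;> rw [Submodule.span_le]
  · rintro _ ⟨n, rfl⟩
    rcases dropZeros_cases (p := p) u n with ⟨k, hk, rfl, h1⟩ | h1
    · rw [h1]; exact Submodule.subset_span ⟨k, rfl⟩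
    · rw [h1]; exact Submodule.zero_mem _
  · rintro _ ⟨k, rfl⟩
    by_cases h : u k = 0
    · rw [h]; exact Submodule.zero_mem _
    · exact Submodule.subset_span ⟨_, dropZeros_eq u (hp k h)⟩

end Reindexing

/-! ### A countable family of indicators dense in every L² -/

section Density

variable {Ω : Type*} [mΩ : MeasurableSpace Ω]

/-- Indicators of a generating `π`-system containing the whole space span a dense subspace of
`L²`. -/
theorem topologicalClosure_span_indicator_eq_top {ι : Type*} {S : ι → Set Ω}
    (hS : ∀ i, MeasurableSet (S i)) (hgen : mΩ = MeasurableSpace.generateFrom (Set.range S))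
    (hpi : IsPiSystem (Set.range S)) (huniv : Set.univ ∈ Set.range S)
    (μ : Measure Ω) [IsFiniteMeasure μ] :
    (Submodule.span ℝ (Set.range fun i =>
      indicatorConstLp 2 (hS i) (measure_ne_top μ _) (1 : ℝ))).topologicalClosure = ⊤ := by
  rw [Submodule.topologicalClosure_eq_top_iff, Submodule.eq_bot_iff]
  intro f hf
  rw [Submodule.mem_orthogonal] at hf
  have hint : Integrable f μ := (Lp.memLp f).integrable (by norm_num)
  have h0 : ∀ i, ∫ ω in S i, f ω ∂μ = 0 := by
    intro i
    have h := hf _ (Submodule.subset_span ⟨i, rfl⟩)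
    rwa [L2.inner_indicatorConstLp_one] at h
  have htot : ∫ ω, f ω ∂μ = 0 := by
    obtain ⟨i, hi⟩ := huniv
    simpa [hi] using h0 i
  -- The sets over which f integrates to zero form a λ-system; closure under complements uses that
  -- the total integral is zero, hence `huniv`.
  have hall : ∀ s, MeasurableSet s → ∫ ω in s, f ω ∂μ = 0 := by
    intro s hs
    induction s, hs using MeasurableSpace.induction_on_inter hgen hpi with
    | empty => simp
    | basic t ht => obtain ⟨i, rfl⟩ := ht; exact h0 i
    | compl t ht ih => rw [setIntegral_compl ht hint, htot, ih, sub_zero]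
    | iUnion t hd hm ih =>
      rw [integral_iUnion hm hd hint.integrableOn]
      simp [ih]
  apply Lp.ext
  refine (hint.ae_eq_zero_of_forall_setIntegral_eq_zero fun s hs _ => hall s hs).trans ?_
  exact (Lp.coeFn_zero _ _ _).symm

/-- A countably generated `σ`-algebra is generated by a sequence of sets forming a `π`-system. -/
theorem exists_seq_generating_piSystem [MeasurableSpace.CountablyGenerated Ω] :
    ∃ S : ℕ → Set Ω, (∀ i, MeasurableSet (S i)) ∧
      mΩ = MeasurableSpace.generateFrom (Set.range S) ∧ IsPiSystem (Set.range S) ∧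
      Set.univ ∈ Set.range S := by
  let 𝒜 := generateSetAlgebra (MeasurableSpace.countableGeneratingSet Ω)
  have hA : IsSetAlgebra 𝒜 := isSetAlgebra_generateSetAlgebra
  have hc : 𝒜.Countable :=
    countable_generateSetAlgebra (MeasurableSpace.countable_countableGeneratingSet (α := Ω))
  obtain ⟨S, hS⟩ := hc.exists_eq_range ⟨_, hA.univ_mem⟩
  have hg : mΩ = MeasurableSpace.generateFrom (Set.range S) := by
    rw [← hS, generateFrom_generateSetAlgebra_eq,
      MeasurableSpace.generateFrom_countableGeneratingSet]
  refine ⟨S, fun i => ?_, hg, ?_, ?_⟩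
  · rw [hg]; exact MeasurableSpace.measurableSet_generateFrom ⟨i, rfl⟩
  · rw [← hS]
    intro s hs t ht _
    exact hA.inter_mem hs ht
  · rw [← hS]; exact hA.univ_mem

end Density

/-! ### Measurability of the reindexing -/

section Measurability

variable {Ω : Type*} [mΩ : MeasurableSpace Ω]

theorem measurable_count {p : Ω → ℕ → Prop} [∀ ω, DecidablePred (p ω)]
    (hp : ∀ k, MeasurableSet {ω | p ω k}) (k : ℕ) : Measurable fun ω => Nat.count (p ω) k := by
  induction k with
  | zero => simp
  | succ k ih =>
    simp only [Nat.count_succ]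
    exact ih.add (Measurable.ite (hp k) measurable_const measurable_const)

/-- Having more than n elements means that some k is the n-th one, a countable union of events about
`Nat.count`; the level sets are differences of such events. -/
theorem measurable_encard {p : Ω → ℕ → Prop}
    (hp : ∀ k, MeasurableSet {ω | p ω k}) : Measurable fun ω => {k | p ω k}.encard := by
  classical
  have hlt : ∀ n : ℕ, MeasurableSet {ω | (n : ℕ∞) < {k | p ω k}.encard} := by
    intro n
    simp only [lt_encard_iff_exists_count, Set.ofPred_exists]
    exact MeasurableSet.iUnion fun k =>
      (hp k).inter (measurable_count hp k (measurableSet_singleton n))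
  refine ENat.measurable_iff.2 fun n => ?_
  cases n with
  | zero =>
    convert (hlt 0).compl using 1
    ext ω
    simp [Set.not_nonempty_iff_eq_empty]
  | succ n =>
    convert (hlt n).diff (hlt (n + 1)) using 1
    ext ω
    simp only [Set.mem_preimage, Set.mem_singleton_iff, Set.mem_sdiff, Set.mem_ofPred_eq, not_lt]
    push_cast
    rw [← ENat.add_one_le_iff (by simp), and_comm]
    exact le_antisymm_iff

/-- The space splits into countably many measurable pieces according to which k is the n-th element,
if any; on each piece the value is `u k` or zero. -/
theorem measurable_dropZeros {p : Ω → ℕ → Prop} (hp : ∀ k, MeasurableSet {ω | p ω k})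
    {u : ℕ → Ω → ℝ} (hu : ∀ k, Measurable (u k)) (n : ℕ) :
    Measurable fun ω => dropZeros (p ω) (fun k => u k ω) n := by
  classical
  intro B hB
  have h : (fun ω => dropZeros (p ω) (fun k => u k ω) n) ⁻¹' B =
      (⋃ k, ({ω | p ω k} ∩ (fun ω => Nat.count (p ω) k) ⁻¹' {n}) ∩ u k ⁻¹' B) ∪
        ({ω | {k | p ω k}.encard ≤ n} ∩ {_ω | (0 : ℝ) ∈ B}) := by
    ext ω
    simp only [Set.mem_preimage, Set.mem_union, Set.mem_iUnion, Set.mem_inter_iff, Set.mem_ofPred_eq,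
      Set.mem_singleton_iff]
    constructor
    · intro h
      by_cases hn : (n : ℕ∞) < {k | p ω k}.encard
      · obtain ⟨k, hk, rfl⟩ := (lt_encard_iff_exists_count _ n).1 hn
        rw [dropZeros_eq _ hk] at h
        exact Or.inl ⟨k, ⟨hk, rfl⟩, h⟩
      · rw [dropZeros_of_le _ (not_lt.1 hn)] at h
        exact Or.inr ⟨not_lt.1 hn, h⟩
    · rintro (⟨k, ⟨hk, rfl⟩, h⟩ | ⟨hn, h⟩)
      · rwa [dropZeros_eq _ hk]
      · rwa [dropZeros_of_le _ hn]
  rw [h]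
  refine (MeasurableSet.iUnion fun k => ((hp k).inter
    (measurable_count hp k (measurableSet_singleton n))).inter (hu k hB)).union ?_
  exact (measurable_encard hp (MeasurableSet.of_discrete (s := Set.Iic (n : ℕ∞)))).inter
    (MeasurableSet.const _)

end Measurability

/-! ### Gram-Schmidt in all fibres simultaneously -/

section GramSchmidt

theorem integral_mul_eq_inner {Ω : Type*} [MeasurableSpace Ω] {μ : Measure Ω} {f g : Ω → ℝ}
    {u v : Lp ℝ 2 μ} (hf : f =ᵐ[μ] u) (hg : g =ᵐ[μ] v) :
    ∫ ω, f ω * g ω ∂μ = inner ℝ u v := by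
  rw [L2.inner_def]
  refine integral_congr_ae ?_
  filter_upwards [hf, hg] with ω h1 h2
  simp [h1, h2, mul_comm]

theorem coeFn_sum_smul {Ω : Type*} [MeasurableSpace Ω] {μ : Measure Ω} {ι : Type*} (s : Finset ι)
    (c : ι → ℝ) (u : ι → Lp ℝ 2 μ) :
    ∀ᵐ ω ∂μ, (∑ i ∈ s, c i • u i : Lp ℝ 2 μ) ω = ∑ i ∈ s, c i * u i ω := by
  classical
  induction s using Finset.induction_on with
  | empty => simpa using! Lp.coeFn_zero ℝ 2 μ
  | insert i s hi ih =>
    simp only [Finset.sum_insert hi]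
    filter_upwards [Lp.coeFn_add (c i • u i) (∑ i ∈ s, c i • u i), Lp.coeFn_smul (c i) (u i), ih]
      with ω h1 h2 h3
    rw [h1, Pi.add_apply, h2, h3, Pi.smul_apply, smul_eq_mul]

variable {Ω : Type*} (G : MeasurableSpace Ω) [mΩ : MeasurableSpace Ω] [StandardBorelSpace Ω]
  (P : Measure Ω) [IsProbabilityMeasure P]

/-- The integral of `f * g` under the conditional law. -/
noncomputable def fibreInner (f g : Ω → ℝ) (ω : Ω) : ℝ :=
  ∫ ω', f ω' * g ω' ∂condExpKernel P G ω

/-- Gram-Schmidt orthogonalization of random variables, simultaneously for all conditional laws. -/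
noncomputable def fibreGramSchmidt (y : ℕ → Ω → ℝ) (k : ℕ) : Ω → ℝ := fun ω =>
  y k ω - ∑ j : Fin k,
    fibreInner G P (fibreGramSchmidt y j) (y k) ω /
      fibreInner G P (fibreGramSchmidt y j) (fibreGramSchmidt y j) ω * fibreGramSchmidt y j ω
termination_by k
decreasing_by all_goals exact j.2

/-- The random vectors obtained from a Gram-Schmidt sequence by normalization. -/
noncomputable def fibreGramSchmidtNormed (y : ℕ → Ω → ℝ) (k : ℕ) (ω : Ω) : ℝ :=
  (√(fibreInner G P (fibreGramSchmidt G P y k) (fibreGramSchmidt G P y k) ω))⁻¹ *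
    fibreGramSchmidt G P y k ω

variable {G P}

theorem fibreGramSchmidt_apply (y : ℕ → Ω → ℝ) (k : ℕ) (ω : Ω) :
    fibreGramSchmidt G P y k ω = y k ω - ∑ j ∈ Finset.range k,
      fibreInner G P (fibreGramSchmidt G P y j) (y k) ω /
        fibreInner G P (fibreGramSchmidt G P y j) (fibreGramSchmidt G P y j) ω *
          fibreGramSchmidt G P y j ω := by
  rw [fibreGramSchmidt, Finset.sum_range]

theorem measurable_fibreInner {f g : Ω → ℝ} (hf : Measurable f) (hg : Measurable g) :
    Measurable[G] (fibreInner G P f g) :=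
  (hf.mul hg).stronglyMeasurable.integral_condExpKernel.measurable

theorem measurable_fibreGramSchmidt (hG : G ≤ mΩ) {y : ℕ → Ω → ℝ} (hy : ∀ k, Measurable (y k))
    (k : ℕ) : Measurable (fibreGramSchmidt G P y k) := by
  induction k using Nat.strong_induction_on with
  | _ k ih =>
    rw [funext (fibreGramSchmidt_apply (G := G) (P := P) y k)]
    refine (hy k).sub (Finset.measurable_sum _ fun j hj => ?_)
    have h := ih j (Finset.mem_range.1 hj)
    exact (((measurable_fibreInner h (hy k)).mono hG le_rfl).div
      ((measurable_fibreInner h h).mono hG le_rfl)).mul h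

/-- The coefficients are 𝓖-measurable, hence constant on almost every fibre; once they are frozen,
the recursion is the usual Gram-Schmidt recursion in L²(κ_ω). -/
theorem fibreGramSchmidt_ae_eq (hG : G ≤ mΩ) {y : ℕ → Ω → ℝ} (hy : ∀ k, Measurable (y k)) :
    ∀ᵐ ω ∂P, ∀ v : ℕ → Lp ℝ 2 (condExpKernel P G ω),
      (∀ k, y k =ᵐ[condExpKernel P G ω] v k) →
      ∀ k, fibreGramSchmidt G P y k =ᵐ[condExpKernel P G ω]
        (gramSchmidt ℝ v k : Lp ℝ 2 (condExpKernel P G ω)) := by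
  have hm := measurable_fibreGramSchmidt (P := P) hG hy
  have hc : ∀ᵐ ω ∂P, ∀ k j, ∀ᵐ ω' ∂condExpKernel P G ω,
      fibreInner G P (fibreGramSchmidt G P y j) (y k) ω' /
        fibreInner G P (fibreGramSchmidt G P y j) (fibreGramSchmidt G P y j) ω' =
      fibreInner G P (fibreGramSchmidt G P y j) (y k) ω /
        fibreInner G P (fibreGramSchmidt G P y j) (fibreGramSchmidt G P y j) ω := by
    rw [ae_all_iff]; intro k
    rw [ae_all_iff]; intro j
    exact ae_condExpKernel_eq_const hG
      ((measurable_fibreInner (hm j) (hy k)).div (measurable_fibreInner (hm j) (hm j)))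
  filter_upwards [hc] with ω hc v hv k
  induction k using Nat.strong_induction_on with
  | _ k ih =>
    rw [gramSchmidt_def, Nat.Iio_eq_range]
    have hcoe : ∀ᵐ ω' ∂condExpKernel P G ω,
        (v k - ∑ j ∈ Finset.range k, (ℝ ∙ gramSchmidt ℝ v j).starProjection (v k) : Lp ℝ 2 _) ω' =
        v k ω' - ∑ j ∈ Finset.range k,
          fibreInner G P (fibreGramSchmidt G P y j) (y k) ω /
          fibreInner G P (fibreGramSchmidt G P y j) (fibreGramSchmidt G P y j) ω *
            (gramSchmidt ℝ v j : Lp ℝ 2 (condExpKernel P G ω)) ω' := by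
      have hproj : ∀ j ∈ Finset.range k, (ℝ ∙ gramSchmidt ℝ v j).starProjection (v k) =
          (fibreInner G P (fibreGramSchmidt G P y j) (y k) ω /
            fibreInner G P (fibreGramSchmidt G P y j) (fibreGramSchmidt G P y j) ω) •
              gramSchmidt ℝ v j := by
        intro j hj
        have hj := ih j (Finset.mem_range.1 hj)
        -- If the earlier vector is zero, division by zero makes the coefficient 0, in agreement
        -- with the projection onto the zero subspace.
        rw [Submodule.starProjection_singleton, fibreInner, fibreInner,
          integral_mul_eq_inner hj (hv k), integral_mul_eq_inner hj hj,
          real_inner_self_eq_norm_sq]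
        rfl
      rw [Finset.sum_congr rfl hproj]
      filter_upwards [Lp.coeFn_sub (v k) (∑ j ∈ Finset.range k,
          (fibreInner G P (fibreGramSchmidt G P y j) (y k) ω /
            fibreInner G P (fibreGramSchmidt G P y j) (fibreGramSchmidt G P y j) ω) •
              gramSchmidt ℝ v j), coeFn_sum_smul (Finset.range k) _ (gramSchmidt ℝ v)]
        with ω' h1 h2
      rw [h1, Pi.sub_apply, h2]
    have hih : ∀ᵐ ω' ∂condExpKernel P G ω, ∀ j, j < k → fibreGramSchmidt G P y j ω' =
        (gramSchmidt ℝ v j : Lp ℝ 2 (condExpKernel P G ω)) ω' := by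
      rw [ae_all_iff]; intro j
      by_cases hj : j < k
      · filter_upwards [ih j hj] with ω' h _ using h
      · exact ae_of_all _ fun _ h => absurd h hj
    filter_upwards [hcoe, hih, ae_all_iff.2 (hc k), hv k] with ω' h1 h2 h3 h4
    rw [h1, ← h4, fibreGramSchmidt_apply]
    congr 1
    refine Finset.sum_congr rfl fun j hj => ?_
    rw [h3 j, h2 j (Finset.mem_range.1 hj)]

/-- A measurable field of orthonormal bases of the spaces `L²` of the conditional laws. -/
theorem exists_fibrewise_basis (hG : G ≤ mΩ) :
    ∃ (d : Ω → ℕ∞) (x : ℕ → Ω → ℝ), Measurable[G] d ∧ (∀ n, Measurable (x n)) ∧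
      (∀ (n : ℕ) ω, d ω ≤ n → x n ω = 0) ∧
      ∀ᵐ ω ∂P, ∃ w : ℕ → Lp ℝ 2 (condExpKernel P G ω),
        (∀ n, x n =ᵐ[condExpKernel P G ω] w n) ∧
        (Pairwise fun i j => inner ℝ (w i) (w j) = 0) ∧
        (∀ n : ℕ, n < d ω → ‖w n‖ = 1) ∧
        ∀ y, Tendsto (fun N => ∑ n ∈ Finset.range N, inner ℝ (w n) y • w n) atTop (nhds y) := by
  obtain ⟨S, hS, hgen, hpi, huniv⟩ := exists_seq_generating_piSystem (Ω := Ω)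
  let y : ℕ → Ω → ℝ := fun k => (S k).indicator fun _ => 1
  have hy : ∀ k, Measurable (y k) := fun k => measurable_const.indicator (hS k)
  have hgs := measurable_fibreGramSchmidt (P := P) hG hy
  -- The k-th Gram-Schmidt vector survives in the fibre of ω. Being phrased through `fibreInner`,
  -- this event lies in 𝓖, and so does the count d.
  let p : Ω → ℕ → Prop := fun ω k =>
    fibreInner G P (fibreGramSchmidt G P y k) (fibreGramSchmidt G P y k) ω ≠ 0
  have hp : ∀ k, MeasurableSet[G] {ω | p ω k} := fun k =>
    (measurable_fibreInner (hgs k) (hgs k) (measurableSet_singleton 0)).compl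
  have he : ∀ k, Measurable (fibreGramSchmidtNormed G P y k) := fun k =>
    ((measurable_fibreInner (hgs k) (hgs k)).mono hG le_rfl).sqrt.inv.mul (hgs k)
  have hconst : ∀ᵐ ω ∂P, ∀ k, ∀ᵐ ω' ∂condExpKernel P G ω,
      fibreInner G P (fibreGramSchmidt G P y k) (fibreGramSchmidt G P y k) ω' =
      fibreInner G P (fibreGramSchmidt G P y k) (fibreGramSchmidt G P y k) ω := by
    rw [ae_all_iff]
    exact fun k => ae_condExpKernel_eq_const hG (measurable_fibreInner (hgs k) (hgs k))
  refine ⟨fun ω => {k | p ω k}.encard,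
    fun n ω => dropZeros (p ω) (fun k => fibreGramSchmidtNormed G P y k ω) n,
    @measurable_encard Ω G p hp, fun n => measurable_dropZeros (fun k => hG _ (hp k)) he n,
    fun n ω h => dropZeros_of_le _ h, ?_⟩
  filter_upwards [hconst, fibreGramSchmidt_ae_eq hG hy] with ω hconst hω
  let v : ℕ → Lp ℝ 2 (condExpKernel P G ω) := fun k =>
    indicatorConstLp 2 (hS k) (measure_ne_top _ _) (1 : ℝ)
  have hv := hω v fun k => indicatorConstLp_coeFn.symm
  let u := gramSchmidtNormed ℝ v
  have hself : ∀ k, fibreInner G P (fibreGramSchmidt G P y k) (fibreGramSchmidt G P y k) ω =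
      ‖gramSchmidt ℝ v k‖ ^ 2 := fun k => by
    rw [fibreInner, integral_mul_eq_inner (hv k) (hv k), real_inner_self_eq_norm_sq]
  have hpu : ∀ k, p ω k ↔ u k ≠ 0 := fun k => by
    simp only [p, u, hself, gramSchmidtNormed]
    simp
  have hunit : ∀ k, u k ≠ 0 → ‖u k‖ = 1 := fun k hk => gramSchmidtNormed_unit_length' hk
  have horth : Pairwise fun i j => inner ℝ (u i) (u j) = 0 := fun i j hij => by
    simp only [u, gramSchmidtNormed]
    rw [inner_smul_left, inner_smul_right, gramSchmidt_orthogonal ℝ v hij, mul_zero, mul_zero]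
  have hspan : (Submodule.span ℝ (Set.range (dropZeros (p ω) u))).topologicalClosure = ⊤ := by
    rw [span_range_dropZeros fun k hk => (hpu k).2 hk, span_gramSchmidtNormed_range,
      span_gramSchmidt]
    exact topologicalClosure_span_indicator_eq_top hS hgen hpi huniv _
  have hnz : ∀ n : ℕ, n < {k | p ω k}.encard → ‖dropZeros (p ω) u n‖ = 1 := by
    classical
    intro n hn
    obtain ⟨k, hk, rfl⟩ := (lt_encard_iff_exists_count _ n).1 hn
    rw [dropZeros_eq u hk]
    exact hunit k ((hpu k).1 hk)
  refine ⟨dropZeros (p ω) u, fun n => ?_, pairwise_inner_dropZeros horth, hnz,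
    tendsto_fourier_of_orthonormal_or_zero (pairwise_inner_dropZeros horth) (fun n hn => ?_) hspan⟩
  · have hek : ∀ᵐ ω' ∂condExpKernel P G ω, ∀ k, fibreGramSchmidtNormed G P y k ω' = u k ω' := by
      rw [ae_all_iff]
      intro k
      filter_upwards [hconst k, hv k, Lp.coeFn_smul (‖gramSchmidt ℝ v k‖⁻¹) (gramSchmidt ℝ v k)]
        with ω' h1 h2 h3
      rw [fibreGramSchmidtNormed, h1, h2, hself, Real.sqrt_sq (norm_nonneg _)]
      exact h3.symm
    filter_upwards [ae_all_iff.2 hconst, hek, Lp.coeFn_zero ℝ 2 (condExpKernel P G ω)]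
      with ω' h1 h2 h3
    -- The set of surviving indices is constant on the fibre, so reindexing pointwise and reindexing
    -- in L²(κ_ω) agree.
    have hpp : p ω' = p ω := by
      ext k
      simp only [p, h1]
    rw [hpp]
    simp only [dropZeros, h2]
    split_ifs
    · rfl
    · exact h3.symm
  · refine hnz n (not_le.1 fun h => hn (dropZeros_of_le u h))

end GramSchmidt

/-! ### Conditional sequences obtained by sampling at random indices -/

section Sampling

theorem measurable_sample {Ω : Type*} [MeasurableSpace Ω] {x : ℕ → Ω → ℝ}
    (hx : ∀ k, Measurable (x k)) {n : Ω → ℕ} (hn : Measurable n) :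
    Measurable fun ω => x (n ω) ω := by
  have h : Measurable fun z : ℕ × Ω => x z.1 z.2 := measurable_from_prod_countable_right hx
  exact h.comp (hn.prodMk measurable_id)

/-- A measurable time after which `g N` stays below `ε`. -/
theorem exists_measurable_threshold {Ω : Type*} [MeasurableSpace Ω] {g : ℕ → Ω → ℝ}
    (hg : ∀ k, Measurable (g k)) {ε : Ω → ℝ} (hε : Measurable ε) :
    ∃ n₀ : Ω → ℕ, Measurable n₀ ∧
      ∀ ω, (∀ᶠ N in atTop, g N ω < ε ω) → ∀ N ≥ n₀ ω, g N ω < ε ω := by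
  classical
  let q : Ω → ℕ → Prop := fun ω N => ∀ M, N ≤ M → g M ω < ε ω
  have hq : ∀ N, MeasurableSet {ω | q ω N} := fun N => by
    simp only [q, Set.ofPred_forall]
    exact MeasurableSet.iInter fun M => MeasurableSet.iInter fun _ =>
      measurableSet_lt (hg M) hε
  -- The second alternative makes the search succeed, with value 0, at points where no threshold
  -- exists.
  have hex : ∀ ω, ∃ N, q ω N ∨ ¬ ∃ N', q ω N' := fun ω => by
    by_cases h : ∃ N', q ω N'
    · exact ⟨h.choose, Or.inl h.choose_spec⟩
    · exact ⟨0, Or.inr h⟩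
  refine ⟨fun ω => Nat.find (hex ω), measurable_find hex fun N => ?_, fun ω h N hN => ?_⟩
  · convert (hq N).union (MeasurableSet.iUnion hq).compl using 1
    ext ω
    simp
  · obtain ⟨N', hN'⟩ := eventually_atTop.1 h
    exact ((Nat.find_spec (hex ω)).resolve_right fun hn => hn ⟨N', hN'⟩) N hN

variable {Ω : Type*} {G : MeasurableSpace Ω} [mΩ : MeasurableSpace Ω] {P : Measure Ω}

/-- The random variable `ω ↦ x (n ω) ω`. -/
noncomputable def sample {x : ℕ → Ω → ℝ} (hx : ∀ k, Measurable (x k)) (n : Ω →ₘ[P] ℕ) :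
    Ω →ₘ[P] ℝ :=
  AEEqFun.mk (fun ω => x (n ω) ω)
    (measurable_sample hx n.stronglyMeasurable.measurable).aestronglyMeasurable

theorem sample_ae_eq {x : ℕ → Ω → ℝ} (hx : ∀ k, Measurable (x k)) (n : Ω →ₘ[P] ℕ) :
    sample hx n =ᵐ[P] fun ω => x (n ω) ω :=
  AEEqFun.coeFn_mk _ _

theorem isCondSeq_sample {x : ℕ → Ω → ℝ} (hx : ∀ k, Measurable (x k)) :
    IsCondSeq fun n : L0N G P => sample hx (n : Ω →ₘ[P] ℕ) := by
  intro A _ ns n h k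
  filter_upwards [h k, sample_ae_eq hx (n : Ω →ₘ[P] ℕ), sample_ae_eq hx (ns k : Ω →ₘ[P] ℕ)]
    with ω h1 h2 h3 hω
  rw [h2, h3, h1 hω]

theorem exists_measurable_rep_L0N (n : L0N G P) :
    ∃ n' : Ω → ℕ, Measurable[G] n' ∧ (n : Ω →ₘ[P] ℕ) =ᵐ[P] n' := by
  obtain ⟨n', h1, h2⟩ := n.2
  exact ⟨n', h1.measurable, h2⟩

theorem sample_mem_L0R {x : ℕ → Ω → ℝ} (hx : ∀ k, Measurable (x k))
    (hxG : ∀ k, Measurable[G] (x k)) (n : L0N G P) : sample hx (n : Ω →ₘ[P] ℕ) ∈ L0R G P := by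
  obtain ⟨n', h1, h2⟩ := exists_measurable_rep_L0N n
  refine ⟨fun ω => x (n' ω) ω, (@measurable_sample Ω G x hxG n' h1).stronglyMeasurable, ?_⟩
  filter_upwards [sample_ae_eq hx (n : Ω →ₘ[P] ℕ), h2] with ω h3 h4
  rw [h3, h4]

/-- The constant conditional natural numbers. -/
noncomputable def constL0N (G : MeasurableSpace Ω) {mΩ : MeasurableSpace Ω} (P : Measure Ω)
    (n : ℕ) : L0N G P :=
  ⟨AEEqFun.const Ω n, aestronglyMeasurable_const.congr (AEEqFun.coeFn_const Ω n).symm⟩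

theorem sample_constL0N {x : ℕ → Ω → ℝ} (hx : ∀ k, Measurable (x k)) (n : ℕ) :
    sample hx (constL0N G P n : Ω →ₘ[P] ℕ) =ᵐ[P] x n := by
  filter_upwards [sample_ae_eq hx (constL0N G P n : Ω →ₘ[P] ℕ),
    AEEqFun.coeFn_const (μ := P) Ω n] with ω h1 h2
  have h3 : (constL0N G P n : Ω →ₘ[P] ℕ) ω = n := h2
  rw [h1, h3]

variable [StandardBorelSpace Ω] [IsProbabilityMeasure P]

/-- A 𝓖-measurable index is constant on the fibre, so there the sampled variable is one member of
the sequence. This reduces statements about all n ∈ L⁰(ℕ) to statements about ordinary n. -/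
theorem sample_fibre_ae_eq (hG : G ≤ mΩ) {x : ℕ → Ω → ℝ} (hx : ∀ k, Measurable (x k))
    (n : L0N G P) : ∀ᵐ ω ∂P, sample hx (n : Ω →ₘ[P] ℕ) =ᵐ[condExpKernel P G ω]
      x ((n : Ω →ₘ[P] ℕ) ω) := by
  obtain ⟨n', h1, h2⟩ := exists_measurable_rep_L0N n
  filter_upwards [ae_ae_condExpKernel_of_ae hG (sample_ae_eq hx (n : Ω →ₘ[P] ℕ)),
    ae_ae_condExpKernel_of_ae hG h2, ae_condExpKernel_eq_const hG h1, h2] with ω h3 h4 h5 h6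
  filter_upwards [h3, h4, h5] with ω' h3 h4 h5
  rw [h3, h4, h5, h6]

theorem sample_mem_L2 (hG : G ≤ mΩ) {x : ℕ → Ω → ℝ} (hx : ∀ k, Measurable (x k))
    (hx2 : ∀ᵐ ω ∂P, ∀ k, MemLp (x k) 2 (condExpKernel P G ω)) (n : L0N G P) :
    sample hx (n : Ω →ₘ[P] ℕ) ∈ L2 G P := by
  rw [mem_L2_iff hG]
  filter_upwards [sample_fibre_ae_eq hG hx n, hx2] with ω h1 h2
  exact (memLp_congr_ae h1).2 (h2 _)

end Sampling

/-! ### The conditional orthonormal basis -/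

section Basis

variable {Ω : Type*} {G : MeasurableSpace Ω} [mΩ : MeasurableSpace Ω] [StandardBorelSpace Ω]
  {P : Measure Ω} [IsProbabilityMeasure P]

/-- A conditional orthonormal basis of conditional dimension `d`, together with finite generation
where the dimension is bounded. -/
theorem exists_isONBOfDim (hG : G ≤ mΩ) :
    ∃ d : Ω → ℕ∞, Measurable[G] d ∧ (∀ᵐ ω ∂P, 1 ≤ d ω) ∧
      (∀ m : ℕ, FinGenOn G P {ω | d ω ≤ m}) ∧
      ∃ x : L0N G P → L2 G P, IsONBOfDim d x := by
  obtain ⟨d, x, hd, hx, hx0, hfib⟩ := exists_fibrewise_basis (P := P) hG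
  have hx2 : ∀ᵐ ω ∂P, ∀ k, MemLp (x k) 2 (condExpKernel P G ω) := by
    filter_upwards [hfib] with ω ⟨w, hw, _⟩ k
    exact (memLp_congr_ae (hw k)).2 (Lp.memLp _)
  let X : L0N G P → L2 G P := fun n => ⟨sample hx n, sample_mem_L2 hG hx hx2 n⟩
  -- Fourier coefficients and partial sums
  let r : (Ω →ₘ[P] ℝ) → ℕ → Ω → ℝ := fun y k => fibreInner G P (x k) y
  have hr : ∀ y k, Measurable[G] (r y k) := fun y k =>
    measurable_fibreInner (hx k) y.stronglyMeasurable.measurable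
  let s : (Ω →ₘ[P] ℝ) → ℕ → Ω → ℝ := fun y N ω => ∑ k ∈ Finset.range N, r y k ω * x k ω
  have hs : ∀ y N, Measurable (s y N) := fun y N =>
    Finset.measurable_sum _ fun k _ => ((hr y k).mono hG le_rfl).mul (hx k)
  have hfib' : ∀ y : L2 G P, ∀ᵐ ω ∂P, ∃ (w : ℕ → Lp ℝ 2 (condExpKernel P G ω))
      (Y : Lp ℝ 2 (condExpKernel P G ω)),
      (∀ n, x n =ᵐ[condExpKernel P G ω] w n) ∧ (y : Ω →ₘ[P] ℝ) =ᵐ[condExpKernel P G ω] Y ∧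
      (∀ N, s y N =ᵐ[condExpKernel P G ω]
        (∑ n ∈ Finset.range N, inner ℝ (w n) Y • w n : Lp ℝ 2 (condExpKernel P G ω))) ∧
      Tendsto (fun N => ∑ n ∈ Finset.range N, inner ℝ (w n) Y • w n) atTop (nhds Y) := by
    intro y
    have hrc : ∀ᵐ ω ∂P, ∀ k, ∀ᵐ ω' ∂condExpKernel P G ω, r y k ω' = r y k ω :=
      ae_all_iff.2 fun k => ae_condExpKernel_eq_const hG (hr y k)
    filter_upwards [hfib, (mem_L2_iff hG _).1 y.2, hrc] with ω ⟨w, hw, _, _, hlim⟩ hy hrc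
    refine ⟨w, hy.toLp, hw, hy.coeFn_toLp.symm, fun N => ?_, hlim _⟩
    filter_upwards [coeFn_sum_smul (Finset.range N) (fun n => inner ℝ (w n) hy.toLp) w,
      ae_all_iff.2 hrc, ae_all_iff.2 hw] with ω' h1 h2 h3
    rw [h1]
    refine Finset.sum_congr rfl fun k _ => ?_
    rw [h2, h3]
    congr 1
    exact integral_mul_eq_inner (hw k) hy.coeFn_toLp.symm
  -- Where d ≤ m, the vectors of index at least m vanish, so the Fourier series of y equals its m-th
  -- partial sum; this is checked in the fibres and then carried back to P.
  have hfin : ∀ (y : L2 G P) (m : ℕ), ∀ᵐ ω ∂P, d ω ≤ m → (y : Ω →ₘ[P] ℝ) ω = s y m ω := by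
    intro y m
    have hym : Measurable (y : Ω →ₘ[P] ℝ) := (y : Ω →ₘ[P] ℝ).stronglyMeasurable.measurable
    have hdm : MeasurableSet {ω | d ω ≤ m} :=
      hd.mono hG le_rfl (MeasurableSet.of_discrete (s := Set.Iic (m : ℕ∞)))
    refine ae_of_ae_ae_condExpKernel hG ?_ ?_
    · have : {ω | d ω ≤ m → (y : Ω →ₘ[P] ℝ) ω = s y m ω} =
          {ω | d ω ≤ m}ᶜ ∪ {ω | (y : Ω →ₘ[P] ℝ) ω = s y m ω} := by
        ext ω
        simp only [Set.mem_ofPred_eq, Set.mem_union, Set.mem_compl_iff]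
        tauto
      rw [this]
      exact hdm.compl.union (measurableSet_eq_fun hym (hs y m))
    · filter_upwards [hfib' y, ae_condExpKernel_eq_const hG hd] with ω ⟨w, Y, hw, hY, hsN, hlim⟩ hdc
      by_cases hω : d ω ≤ m
      · have hw0 : ∀ n, m ≤ n → w n = 0 := fun n hn => by
          apply Lp.ext
          filter_upwards [hw n, hdc, Lp.coeFn_zero ℝ 2 (condExpKernel P G ω)] with ω' h1 h2 h3
          rw [← h1, h3, Pi.zero_apply]
          exact hx0 n ω' (h2 ▸ hω.trans (by exact_mod_cast hn))
        have hconst : ∀ N ≥ m, ∑ n ∈ Finset.range N, inner ℝ (w n) Y • w n =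
            ∑ n ∈ Finset.range m, inner ℝ (w n) Y • w n := fun N hN => by
          refine (Finset.sum_subset (Finset.range_mono hN) fun n _ hn => ?_).symm
          rw [hw0 n (by simpa using hn), smul_zero]
        have hYm : Y = ∑ n ∈ Finset.range m, inner ℝ (w n) Y • w n :=
          tendsto_nhds_unique hlim (tendsto_atTop_of_eventually_const hconst)
        filter_upwards [hY, hsN m] with ω' h1 h2 _
        rw [h1, h2, ← hYm]
      · filter_upwards [hdc] with ω' h1 h2
        exact absurd (h1 ▸ h2) hω
  refine ⟨d, hd, ?_, ?_, X, ?_⟩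
  -- Where d = 0, the constant 1 would equal an empty Fourier sum.
  · have h1 : AEEqFun.mk (fun _ : Ω => (1 : ℝ)) aestronglyMeasurable_const ∈ L2 G P :=
      mk_mem_L2 hG _ (ae_of_all _ fun ω => memLp_const 1)
    filter_upwards [hfin ⟨_, h1⟩ 0, AEEqFun.coeFn_mk (μ := P) (fun _ : Ω => (1 : ℝ))
      aestronglyMeasurable_const] with ω h2 h3
    rw [Order.one_le_iff_ne_zero]
    intro h0
    have h4 := h2 (by simp [h0])
    rw [h3] at h4
    simp [s] at h4
  · intro m
    refine ⟨m, fun i => X (constL0N G P i), fun y => ⟨fun i => ⟨AEEqFun.mk (r y i)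
      ((hr y i).mono hG le_rfl).aestronglyMeasurable,
      ⟨r y i, (hr y i).stronglyMeasurable, AEEqFun.coeFn_mk _ _⟩⟩, ?_⟩⟩
    have h1 : ∀ᵐ ω ∂P, ∀ i : Fin m, AEEqFun.mk (r y i)
        ((hr y i).mono hG le_rfl).aestronglyMeasurable ω = r y i ω :=
      ae_all_iff.2 fun i => AEEqFun.coeFn_mk (μ := P) _ _
    have h2 : ∀ᵐ ω ∂P, ∀ i : Fin m, (X (constL0N G P i) : Ω →ₘ[P] ℝ) ω = x i ω :=
      ae_all_iff.2 fun i => sample_constL0N hx i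
    filter_upwards [hfin y m, h1, h2] with ω h0 h1 h2 hω
    refine (h0 hω).trans ((Finset.sum_range _).trans ?_)
    exact Finset.sum_congr rfl fun i _ => by rw [h1, h2]
  · have hself : ∀ n : L0N G P, ∀ᵐ ω ∂P, ((n : Ω →ₘ[P] ℕ) ω : ℕ∞) < d ω → cnorm (X n) ω = 1 := by
      intro n
      filter_upwards [cinner_ae_eq hG (X n) (X n), sample_fibre_ae_eq hG hx n, hfib]
        with ω h1 h2 ⟨w, hw, _, hunit, _⟩ hω
      have h3 := h2.trans (hw _)
      rw [cnorm, h1, integral_mul_eq_inner h3 h3, real_inner_self_eq_norm_sq, hunit _ hω]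
      simp
    refine ⟨isCondSeq_sample hx, fun n m hnm => ?_, hself, fun n => ?_, fun y => ?_⟩
    · have hne : ∀ᵐ ω ∂P, (n : Ω →ₘ[P] ℕ) ω ≠ (m : Ω →ₘ[P] ℕ) ω := by
        rw [ae_iff]; simpa using hnm
      filter_upwards [cinner_ae_eq hG (X n) (X m), sample_fibre_ae_eq hG hx n,
        sample_fibre_ae_eq hG hx m, hfib, hne] with ω h1 h2 h3 ⟨w, hw, horth, _⟩ hω
      rw [h1, integral_mul_eq_inner (h2.trans (hw _)) (h3.trans (hw _)), horth hω]
    · filter_upwards [sample_ae_eq hx (n : Ω →ₘ[P] ℕ)] with ω h1 hω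
      exact h1.trans (hx0 _ ω hω)
    · have hs2 : ∀ᵐ ω ∂P, ∀ N, MemLp (s y N) 2 (condExpKernel P G ω) := by
        filter_upwards [hfib' y] with ω ⟨w, Y, _, _, h, _⟩ N
        exact (memLp_congr_ae (h N)).2 (Lp.memLp _)
      have hrm : ∀ k, Measurable (r y k) := fun k => (hr y k).mono hG le_rfl
      refine ⟨fun n => ⟨sample hrm n, sample_mem_L0R hrm (hr y) n⟩, isCondSeq_sample hrm,
        fun n => ⟨sample (hs y) n, sample_mem_L2 hG (hs y) hs2 n⟩, isCondSeq_sample (hs y),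
        ?_, fun n => ?_, fun ε hε => ?_⟩
      · apply Subtype.ext
        apply AEEqFun.ext
        filter_upwards [sample_ae_eq (hs y) ((0 : L0N G P) : Ω →ₘ[P] ℕ),
          AEEqFun.coeFn_zero (μ := P) (α := Ω) (β := ℕ),
          AEEqFun.coeFn_zero (μ := P) (α := Ω) (β := ℝ)] with ω h1 h2 h3
        refine h1.trans ?_
        have h4 : ((0 : L0N G P) : Ω →ₘ[P] ℕ) ω = 0 := h2
        rw [h4]
        exact h3.symm
      · apply Subtype.ext
        apply AEEqFun.ext
        filter_upwards [sample_ae_eq (hs y) ((n + 1 : L0N G P) : Ω →ₘ[P] ℕ),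
          AEEqFun.coeFn_add (n : Ω →ₘ[P] ℕ) 1,
          AEEqFun.coeFn_one (μ := P) (α := Ω) (β := ℕ),
          AEEqFun.coeFn_add (sample (hs y) (n : Ω →ₘ[P] ℕ))
            (sample hrm (n : Ω →ₘ[P] ℕ) * sample hx (n : Ω →ₘ[P] ℕ)),
          AEEqFun.coeFn_mul (sample hrm (n : Ω →ₘ[P] ℕ)) (sample hx (n : Ω →ₘ[P] ℕ)),
          sample_ae_eq (hs y) (n : Ω →ₘ[P] ℕ), sample_ae_eq hrm (n : Ω →ₘ[P] ℕ),
          sample_ae_eq hx (n : Ω →ₘ[P] ℕ)] with ω h1 h2 h3 h4 h5 h6 h7 h8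
        refine h1.trans (Eq.trans ?_ h4.symm)
        have h9 : ((n + 1 : L0N G P) : Ω →ₘ[P] ℕ) ω = (n : Ω →ₘ[P] ℕ) ω + 1 := by
          refine h2.trans ?_
          rw [Pi.add_apply, h3, Pi.one_apply]
        rw [h9, Pi.add_apply, h5, Pi.mul_apply, h6, h7, h8]
        exact Finset.sum_range_succ _ _
      · obtain ⟨ε', hε'm, hεε'⟩ := ε.2
        -- The conditional norm of the N-th Fourier remainder: 𝓖-measurable in ω and, for almost
        -- every ω, tending to 0 as N grows.
        let g : ℕ → Ω → ℝ := fun N ω => √(fibreInner G P (fun ω => s y N ω - (y : Ω →ₘ[P] ℝ) ω)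
          (fun ω => s y N ω - (y : Ω →ₘ[P] ℝ) ω) ω)
        have hym : Measurable (y : Ω →ₘ[P] ℝ) := (y : Ω →ₘ[P] ℝ).stronglyMeasurable.measurable
        have hg : ∀ N, Measurable[G] (g N) := fun N =>
          (measurable_fibreInner ((hs y N).sub hym) ((hs y N).sub hym)).sqrt
        have hglim : ∀ᵐ ω ∂P, Tendsto (fun N => g N ω) atTop (nhds 0) := by
          filter_upwards [hfib' y] with ω ⟨w, Y, hw, hY, hsN, hlim⟩
          have h := (hlim.sub_const Y).norm
          rw [sub_self, norm_zero] at h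
          refine h.congr fun N => ?_
          have h1 : (fun ω => s y N ω - (y : Ω →ₘ[P] ℝ) ω) =ᵐ[condExpKernel P G ω]
              ((∑ n ∈ Finset.range N, inner ℝ (w n) Y • w n) - Y :
                Lp ℝ 2 (condExpKernel P G ω)) :=
            ((hsN N).sub hY).trans (Lp.coeFn_sub _ _).symm
          simp only [g, fibreInner]
          rw [integral_mul_eq_inner h1 h1, real_inner_self_eq_norm_sq,
            Real.sqrt_sq (norm_nonneg _)]
        -- The threshold is chosen measurably for 𝓖, so it defines an element of L⁰(ℕ). For n ≥ n₀
        -- the remainder at n has norm g(n(ω))(ω) at ω.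
        obtain ⟨n₀, hn₀m, hn₀⟩ := @exists_measurable_threshold Ω G g hg ε' hε'm.measurable
        refine ⟨⟨AEEqFun.mk n₀ (hn₀m.mono hG le_rfl).aestronglyMeasurable,
          ⟨n₀, hn₀m.stronglyMeasurable, AEEqFun.coeFn_mk _ _⟩⟩, fun n hn => ?_⟩
        filter_upwards [hε, hεε', hglim, AEEqFun.coeFn_le.2 hn,
          AEEqFun.coeFn_mk n₀ (hn₀m.mono hG le_rfl).aestronglyMeasurable,
          cinner_ae_eq hG (⟨sample (hs y) n, sample_mem_L2 hG (hs y) hs2 n⟩ - y)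
            (⟨sample (hs y) n, sample_mem_L2 hG (hs y) hs2 n⟩ - y),
          sample_fibre_ae_eq hG (hs y) n, ae_ae_condExpKernel_of_ae hG
            (AEEqFun.coeFn_sub (sample (hs y) (n : Ω →ₘ[P] ℕ)) (y : Ω →ₘ[P] ℝ))]
          with ω h1 h2 h3 h4 h5 h6 h7 h8
        rw [h2] at h1 ⊢
        have h9 := hn₀ ω (h3.eventually_lt_const h1) ((n : Ω →ₘ[P] ℕ) ω) (h5 ▸ h4)
        refine lt_of_eq_of_lt ?_ h9
        rw [cnorm, h6]
        simp only [g, fibreInner]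
        congr 1
        refine integral_congr_ae ?_
        filter_upwards [h7, h8] with ω' h7 h8
        have h10 : ((⟨sample (hs y) n, sample_mem_L2 hG (hs y) hs2 n⟩ - y : L2 G P) :
            Ω →ₘ[P] ℝ) ω' = s y ((n : Ω →ₘ[P] ℕ) ω) ω' - (y : Ω →ₘ[P] ℝ) ω' := by
          refine h8.trans ?_
          rw [Pi.sub_apply, h7]
        rw [h10]

/-- If the space is conditionally infinite dimensional, its dimension is almost surely infinite. -/
theorem exists_isONB (hG : G ≤ mΩ) (h : CondInfiniteDim G P) :
    ∃ x : L0N G P → L2 G P, IsONB x := by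
  obtain ⟨d, hd, -, hfin, x, hx⟩ := exists_isONBOfDim (P := P) hG
  -- The module is finitely generated on {d ≤ m}, so conditional infinite dimension makes this set
  -- null.
  have hnull : ∀ m : ℕ, P {ω | d ω ≤ m} = 0 := fun m => by
    by_contra hm
    exact h _ (hd (MeasurableSet.of_discrete (s := Set.Iic (m : ℕ∞)))) hm (hfin m)
  have hgt : ∀ᵐ ω ∂P, ∀ m : ℕ, (m : ℕ∞) < d ω :=
    ae_all_iff.2 fun m => by
      rw [ae_iff]
      simpa using hnull m
  refine ⟨x, hx.condSeq, hx.orthogonal, fun n => ?_, hx.generating⟩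
  filter_upwards [hx.normalized n, hgt] with ω h1 h2
  exact h1 (h2 _)

end Basis

/-! ### Non-existence of algebraic bases over an infinite base -/

section AlgebraicBasis

variable {Ω : Type*} {G : MeasurableSpace Ω} [mΩ : MeasurableSpace Ω]

/-- A measurable labelling of the members of a disjoint sequence of measurable sets. -/
theorem exists_measurable_label {Ω : Type*} [MeasurableSpace Ω] {A : ℕ → Set Ω}
    (hA : ∀ k, MeasurableSet (A k)) (hd : Pairwise (Function.onFun Disjoint A)) :
    ∃ n : Ω → ℕ, Measurable n ∧ ∀ k, ∀ ω ∈ A k, n ω = k := by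
  classical
  have hex : ∀ ω, ∃ k, ω ∈ A k ∨ ω ∉ ⋃ k, A k := fun ω => by
    by_cases h : ω ∈ ⋃ k, A k
    · obtain ⟨k, hk⟩ := Set.mem_iUnion.1 h
      exact ⟨k, Or.inl hk⟩
    · exact ⟨0, Or.inr h⟩
  refine ⟨fun ω => Nat.find (hex ω), measurable_find hex fun k =>
    (hA k).union (MeasurableSet.iUnion hA).compl, fun k ω hω => ?_⟩
  have h := (Nat.find_spec (hex ω)).resolve_right fun h => h (Set.mem_iUnion.2 ⟨k, hω⟩)
  by_contra hne
  exact Set.disjoint_left.1 (hd hne) h hω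

/-- The indicator of a `𝓖`-measurable set as a scalar. -/
noncomputable def indicatorL0R (hG : G ≤ mΩ) (P : Measure Ω) {A : Set Ω}
    (hA : MeasurableSet[G] A) : L0R G P :=
  ⟨AEEqFun.mk (A.indicator fun _ => (1 : ℝ))
      (measurable_const.indicator (hG A hA)).aestronglyMeasurable,
    ⟨A.indicator fun _ => 1, (measurable_const.indicator hA).stronglyMeasurable,
      AEEqFun.coeFn_mk _ _⟩⟩

theorem indicatorL0R_ae_eq (hG : G ≤ mΩ) (P : Measure Ω) {A : Set Ω} (hA : MeasurableSet[G] A) :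
    (indicatorL0R hG P hA : Ω →ₘ[P] ℝ) =ᵐ[P] A.indicator fun _ => 1 :=
  AEEqFun.coeFn_mk _ _

theorem indicatorL0R_ne_zero (hG : G ≤ mΩ) {P : Measure Ω} {A : Set Ω} (hA : MeasurableSet[G] A)
    (h : P A ≠ 0) : indicatorL0R hG P hA ≠ 0 := by
  intro h0
  have h0' : (indicatorL0R hG P hA : Ω →ₘ[P] ℝ) = 0 := by rw [h0]; rfl
  apply h
  rw [measure_eq_zero_iff_ae_notMem]
  filter_upwards [indicatorL0R_ae_eq hG P hA, AEEqFun.coeFn_zero (μ := P) (α := Ω) (β := ℝ)]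
    with ω h1 h2 hω
  rw [h0', h2] at h1
  simp [hω] at h1

/-- Elements of `L²(𝓕|𝓖)` that agree on `A` agree after multiplication by its indicator. -/
theorem indicatorL0R_smul_congr (hG : G ≤ mΩ) {P : Measure Ω} {A : Set Ω}
    (hA : MeasurableSet[G] A) {x y : L2 G P}
    (h : ∀ᵐ ω ∂P, ω ∈ A → (x : Ω →ₘ[P] ℝ) ω = (y : Ω →ₘ[P] ℝ) ω) :
    indicatorL0R hG P hA • x = indicatorL0R hG P hA • y := by
  apply Subtype.ext
  apply AEEqFun.ext
  filter_upwards [h, indicatorL0R_ae_eq hG P hA,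
    AEEqFun.coeFn_mul (indicatorL0R hG P hA : Ω →ₘ[P] ℝ) (x : Ω →ₘ[P] ℝ),
    AEEqFun.coeFn_mul (indicatorL0R hG P hA : Ω →ₘ[P] ℝ) (y : Ω →ₘ[P] ℝ)] with ω h1 h2 h3 h4
  refine h3.trans (Eq.trans ?_ h4.symm)
  rw [Pi.mul_apply, Pi.mul_apply, h2]
  by_cases hω : ω ∈ A
  · rw [h1 hω]
  · simp [hω]

variable {P : Measure Ω}

theorem finGenOn_univ_of_finite (h : Module.Finite (L0R G P) (L2 G P)) :
    FinGenOn G P Set.univ := by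
  obtain ⟨k, g, hg⟩ := Module.Finite.exists_fin (R := L0R G P) (M := L2 G P)
  refine ⟨k, g, fun y => ?_⟩
  have hy : y ∈ Submodule.span (L0R G P) (Set.range g) := hg ▸ Submodule.mem_top
  obtain ⟨r, hr⟩ := (Submodule.mem_span_range_iff_exists_fun _).1 hy
  refine ⟨r, ?_⟩
  have h1 : (y : Ω →ₘ[P] ℝ) = ∑ i, (r i : Ω →ₘ[P] ℝ) * (g i : Ω →ₘ[P] ℝ) := by
    rw [← hr, Submodule.coe_sum]
    rfl
  have h2 : ∀ᵐ ω ∂P, ∀ i, ((r i : Ω →ₘ[P] ℝ) * (g i : Ω →ₘ[P] ℝ) : Ω →ₘ[P] ℝ) ω =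
      (r i : Ω →ₘ[P] ℝ) ω * (g i : Ω →ₘ[P] ℝ) ω :=
    ae_all_iff.2 fun i => AEEqFun.coeFn_mul _ _
  filter_upwards [h2, AEEqFun.coeFn_fun_finsetSum Finset.univ
    fun i => (r i : Ω →ₘ[P] ℝ) * (g i : Ω →ₘ[P] ℝ)] with ω h2 h3 _
  rw [h1, h3]
  exact Finset.sum_congr rfl fun i _ => h2 i

variable [StandardBorelSpace Ω] [IsProbabilityMeasure P]

/-- Over an infinite base, only finitely generated spaces are free. -/
theorem not_free_of_not_finite (hG : G ≤ mΩ) {A : ℕ → Set Ω} (hA : ∀ k, MeasurableSet[G] (A k))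
    (hP : ∀ k, P (A k) ≠ 0) (hd : Pairwise (Function.onFun Disjoint A))
    (hfin : ¬ Module.Finite (L0R G P) (L2 G P)) : ¬ Module.Free (L0R G P) (L2 G P) := by
  intro hfree
  let b := Module.Free.chooseBasis (L0R G P) (L2 G P)
  have hinf : Infinite (Module.Free.ChooseBasisIndex (L0R G P) (L2 G P)) := by
    by_contra h
    rw [not_infinite_iff_finite] at h
    exact hfin (Module.Finite.of_basis b)
  let f := Infinite.natEmbedding (Module.Free.ChooseBasisIndex (L0R G P) (L2 G P))
  obtain ⟨n, hn, hnA⟩ := @exists_measurable_label Ω G A hA hd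
  let x : ℕ → Ω → ℝ := fun k => (b (f k) : Ω →ₘ[P] ℝ)
  have hx : ∀ k, Measurable (x k) := fun k => AEEqFun.measurable _
  let N : L0N G P := ⟨AEEqFun.mk n (hn.mono hG le_rfl).aestronglyMeasurable,
    ⟨n, hn.stronglyMeasurable, AEEqFun.coeFn_mk _ _⟩⟩
  -- The element equal to `b (f k)` on A_k. It needs no uniform bound on the basis vectors, since
  -- membership in `L2` is tested fibre by fibre; outside all A_k the label is immaterial.
  let y : L2 G P := ⟨sample hx N, sample_mem_L2 hG hx
    (ae_all_iff.2 fun k => (mem_L2_iff hG _).1 (b (f k)).2) N⟩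
  have hy : ∀ k, indicatorL0R hG P (hA k) • y = indicatorL0R hG P (hA k) • b (f k) := fun k => by
    refine indicatorL0R_smul_congr hG (hA k) ?_
    filter_upwards [sample_ae_eq hx (N : Ω →ₘ[P] ℕ),
      AEEqFun.coeFn_mk n (hn.mono hG le_rfl).aestronglyMeasurable] with ω h1 h2 hω
    refine h1.trans ?_
    have h3 : (N : Ω →ₘ[P] ℕ) ω = k := h2.trans (hnA k ω hω)
    rw [h3]
  -- Comparing the coordinates at `f k` in 1_{A_k} y = 1_{A_k} b_{f k}: if that of y were zero, the
  -- scalar 1_{A_k} would be zero, although A_k is not null.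
  have hne : ∀ k, b.repr y (f k) ≠ 0 := fun k h0 => by
    have h := congrArg (fun z => b.repr z (f k)) (hy k)
    simp [h0] at h
    exact indicatorL0R_ne_zero hG (hA k) (hP k) h.symm
  have hsub : Set.range f ⊆ (b.repr y).support := by
    rintro _ ⟨k, rfl⟩
    simpa using hne k
  exact Set.infinite_range_of_injective f.injective ((Finset.finite_toSet _).subset hsub)

end AlgebraicBasis

/-! ### An infinite dimensional example on a countable grid -/

section Example

/-- A probability measure on `ℕ × ℕ` charging every point. -/
noncomputable def gridMeasure : Measure (ℕ × ℕ) := (Measure.count : Measure (ℕ × ℕ)).toFinite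

instance : IsProbabilityMeasure gridMeasure := by
  unfold gridMeasure
  infer_instance

theorem forall_of_ae_gridMeasure {q : ℕ × ℕ → Prop} (h : ∀ᵐ ω ∂gridMeasure, q ω) (ω : ℕ × ℕ) :
    q ω := by
  have h1 : ∀ᵐ ω ∂(Measure.count : Measure (ℕ × ℕ)), q ω :=
    (absolutelyContinuous_toFinite _).ae_le h
  by_contra hω
  have h2 : Measure.count {ω : ℕ × ℕ | ¬ q ω} = 0 := h1
  rw [Measure.count_eq_zero_iff] at h2
  exact Set.notMem_empty ω (h2 ▸ hω)

theorem gridMeasure_ne_zero {A : Set (ℕ × ℕ)} (h : A.Nonempty) : gridMeasure A ≠ 0 := by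
  intro h0
  obtain ⟨ω, hω⟩ := h
  exact forall_of_ae_gridMeasure (measure_eq_zero_iff_ae_notMem.1 h0) ω hω

/-- The `σ`-algebra of the first coordinate on `ℕ × ℕ`. -/
abbrev firstCoord : MeasurableSpace (ℕ × ℕ) := MeasurableSpace.comap Prod.fst inferInstance

theorem firstCoord_le : firstCoord ≤ (inferInstance : MeasurableSpace (ℕ × ℕ)) :=
  measurable_fst.comap_le

theorem eq_of_measurable_firstCoord {r : ℕ × ℕ → ℝ} (hr : Measurable[firstCoord] r) (a i j : ℕ) :
    r (a, i) = r (a, j) := by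
  obtain ⟨B, -, hB⟩ := MeasurableSpace.measurableSet_comap.1 (hr (measurableSet_singleton (r (a, j))))
  have hj : (a, j) ∈ Prod.fst ⁻¹' B := hB ▸ rfl
  have hi : (a, i) ∈ Prod.fst ⁻¹' B := hj
  rw [hB] at hi
  exact hi

/-- Scalars depend only on the first coordinate, so on a column {a} × ℕ contained in A they are real
numbers. Finitely many generators would then span all unit vectors of ℕ → ℝ over ℝ, and these are
linearly independent. -/
theorem condInfiniteDim_grid : CondInfiniteDim firstCoord gridMeasure := by
  rintro A hA hPA ⟨k, g, hg⟩
  obtain ⟨B, -, rfl⟩ := MeasurableSpace.measurableSet_comap.1 hA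
  obtain ⟨⟨a, b⟩, hab⟩ := nonempty_of_measure_ne_zero hPA
  let v : Fin k → ℕ → ℝ := fun i j => (g i : ℕ × ℕ →ₘ[gridMeasure] ℝ) (a, j)
  have hmem : ∀ j : ℕ, (Pi.single j 1 : ℕ → ℝ) ∈ Submodule.span ℝ (Set.range v) := by
    intro j
    have hm : Measurable (({(a, j)} : Set (ℕ × ℕ)).indicator fun _ => (1 : ℝ)) :=
      measurable_const.indicator (measurableSet_singleton _)
    obtain ⟨r, hr⟩ := hg ⟨_, mk_mem_L2 firstCoord_le hm.aestronglyMeasurable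
      (ae_of_all _ fun ω => (memLp_const (1 : ℝ)).indicator (measurableSet_singleton _))⟩
    refine (Submodule.mem_span_range_iff_exists_fun _).2
      -- Any row would serve in place of 0, since r i is constant along the column.
      ⟨fun i => (r i : ℕ × ℕ →ₘ[gridMeasure] ℝ) (a, 0), ?_⟩
    ext l
    have hrl : ∀ i, (r i : ℕ × ℕ →ₘ[gridMeasure] ℝ) (a, l) =
        (r i : ℕ × ℕ →ₘ[gridMeasure] ℝ) (a, 0) := fun i => by
      obtain ⟨r', h1, h2⟩ := (r i).2
      rw [forall_of_ae_gridMeasure h2, forall_of_ae_gridMeasure h2]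
      exact eq_of_measurable_firstCoord h1.measurable a l 0
    have h1 := forall_of_ae_gridMeasure hr (a, l) hab
    have h2 := forall_of_ae_gridMeasure
      (AEEqFun.coeFn_mk (μ := gridMeasure) _ hm.aestronglyMeasurable) (a, l)
    have h3 := h2.symm.trans h1
    simp only [Finset.sum_apply, Pi.smul_apply, smul_eq_mul, v]
    simp only [hrl] at h3
    rw [← h3]
    by_cases hl : l = j
    · simp [hl]
    · simp [hl]
  have hfinite := LinearIndependent.finite_of_le_span_finite _
    (Pi.linearIndependent_single_one ℕ ℝ) (Set.range v)
    (by rintro _ ⟨j, rfl⟩; exact hmem j)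
  exact not_finite ℕ

/-- The columns are the disjoint non-null sets of the base along which basis vectors are glued. -/
theorem not_free_grid :
    ¬ Module.Free (L0R firstCoord gridMeasure) (L2 firstCoord gridMeasure) := by
  refine not_free_of_not_finite firstCoord_le (A := fun k => Prod.fst ⁻¹' {k})
    (fun k => ⟨{k}, measurableSet_singleton k, rfl⟩)
    (fun k => gridMeasure_ne_zero ⟨(k, 0), rfl⟩) (fun i j hij => ?_) fun h => ?_
  · exact Disjoint.preimage _ (Set.disjoint_singleton.2 hij)
  · exact condInfiniteDim_grid Set.univ MeasurableSet.univ (gridMeasure_ne_zero Set.univ_nonempty)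
      (finGenOn_univ_of_finite h)

end Example

end CondHilbert

theorem mainTheorem5 {Ω : Type*} (G : MeasurableSpace Ω) [mΩ : MeasurableSpace Ω]
    [StandardBorelSpace Ω]
    (P : MeasureTheory.Measure Ω) [MeasureTheory.IsProbabilityMeasure P]
    (hG : G ≤ mΩ) :
    -- a conditional orthonormal basis indexed by all of `L⁰(ℕ)`
    (CondHilbert.CondInfiniteDim G P →
      ∃ x : CondHilbert.L0N G P → CondHilbert.L2 G P, CondHilbert.IsONB x) ∧
    -- without any assumption on the dimension, the basis is indexed by the `n < d`
    (∃ d : Ω → ℕ∞, Measurable[G] d ∧ (∀ᵐ ω ∂P, 1 ≤ d ω) ∧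
      ∃ x : CondHilbert.L0N G P → CondHilbert.L2 G P, CondHilbert.IsONBOfDim d x) ∧
    -- over an infinite base, an algebraic basis exists only if the module is finitely generated
    ((∃ A : ℕ → Set Ω, (∀ k, MeasurableSet[G] (A k)) ∧ (∀ k, P (A k) ≠ 0) ∧
        Pairwise (Function.onFun Disjoint A)) →
      ¬ Module.Finite (CondHilbert.L0R G P) (CondHilbert.L2 G P) →
      ¬ Module.Free (CondHilbert.L0R G P) (CondHilbert.L2 G P)) ∧
    -- and there are conditionally infinite dimensional spaces without an algebraic basis
    (∃ (Ω' : Type) (G' : MeasurableSpace Ω') (mΩ' : MeasurableSpace Ω') (_ : StandardBorelSpace Ω')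
      (P' : MeasureTheory.Measure Ω') (_ : MeasureTheory.IsProbabilityMeasure P'),
      G' ≤ mΩ' ∧ CondHilbert.CondInfiniteDim G' P' ∧
        ¬ Module.Free (CondHilbert.L0R G' P') (CondHilbert.L2 G' P')) := by
  refine ⟨CondHilbert.exists_isONB hG, ?_, ?_, ?_⟩
  · obtain ⟨d, hd, hd1, -, x, hx⟩ := CondHilbert.exists_isONBOfDim (P := P) hG
    exact ⟨d, hd, hd1, x, hx⟩
  · rintro ⟨A, hA, hP, hdisj⟩ hfin
    exact CondHilbert.not_free_of_not_finite hG hA hP hdisj hfin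
  · exact ⟨ℕ × ℕ, CondHilbert.firstCoord, inferInstance, inferInstance, CondHilbert.gridMeasure,
      inferInstance, CondHilbert.firstCoord_le, CondHilbert.condInfiniteDim_grid,
      CondHilbert.not_free_grid⟩
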